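/- **Setting.** Let $r\ge 1$ and $k_{\max}\ge r$ be fixed. For every sample size $n$ let $Y=X\beta+\varepsilon\in\mathbb R^n$ with $X=F\Lambda^T+E\in\mathbb R^{n\times p}$, where $p=p_n$, $F\in\mathbb R^{n\times r}$ (rows $f_t$) and $E=(e_{tj})\in\mathbb R^{n\times p}$ and $\varepsilon\in\mathbb R^n$ are random, $\Lambda\in\mathbb R^{p\times r}$ (rows $\lambda_j$) and $\beta\in\mathbb R^p$ are nonrandom; all quantities may depend on $n$. Let $J=J_n\subset\{1,\dots,p\}$ be nonrandom with $m=m_n$ elements; a subscript $J$ selects the columns (entries) in $J$. $\|\cdot\|$ is the Frobenius norm, $\|\cdot\|_{op}$ the spectral norm, $M$ a constant, and the bounds hold for all $n$. **Assumptions.** (A) $p\ge cn$ for some $c>0$ and all large $n$; $m^2/n\to0$; $\sum_j|\beta_j|\le M$; $\frac1n\sum_{t}\varepsilon_t^2=O_p(1)$. (B) $E\|f_t\|^4$ is finite, for each fixed $t$ bounded in $n$, and $\frac1nF^TF\to\Sigma_F$ in probability with $\Sigma_F$ positive definite; $\|\lambda_j\|\le\bar\lambda<\infty$ and $\frac1p\Lambda^T\Lambda\to\Sigma_\Lambda$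 with $\Sigma_\Lambda$ positive definite; $Ee_{ti}=0$ and $E|e_{ti}|^8\le M$; with $\gamma(s,t)=E(\frac1p\sum_ie_{si}e_{ti})$, $|\gamma(s,s)|\le M$ and $\frac1n\sum_{s,t}|\gamma(s,t)|\le M$; $|E(e_{ti}e_{tj})|\le|\tau_{ij}|$ for all $t$, with $\frac1p\sum_{i,j}|\tau_{ij}|\le M$; $\frac1{np}\sum_{i,j,t,s}|E(e_{ti}e_{sj})|\le M$; $E|p^{-1/2}\sum_i[e_{si}e_{ti}-E(e_{si}e_{ti})]|^4\le M$ for all $s,t$; $E\big(\frac1p\sum_i\|n^{-1/2}\sum_tf_te_{ti}\|^2\big)\le M$. (C) $\|\frac1nE_J^TE_J-G_J\|\to0$ in probability for positive definite matrices $G_J=G_{J_n}$ whose smallest eigenvalues are bounded below by a positive constant; $E\big(\frac1m\sum_{j\in J}\|n^{-1/2}\sum_tf_te_{tj}\|^2\big)\le M$; $E\big(\frac1m\sum_{j\in J}(n^{-1/2}\sum_t\varepsilon_te_{tj})^2\big)\le M$; and $E\big(\frac1m\sum_{j\in J}(n^{-1/2}\sum_te_{ti}e_{tj})^2\big)\le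 M$ for every $i\notin J$. **Estimators.** For $1\le k\le k_{\max}$ let $\bar\Lambda^k$ be $\sqrt p$ times orthonormal eigenvectors of $X^TX$ for its $k$ largest eigenvalues, $\bar F^k=X\bar\Lambda^k/p$, $\hat F^k=\bar F^k\big((\bar F^k)^T\bar F^k/n\big)^{1/2}$, $V(k)=\min_{L\in\mathbb R^{p\times k}}\|X-\hat F^kL^T\|^2$, and let $\hat k$ minimise $\log V(k)+k\frac{n+p}{np}\log\frac{np}{n+p}$ over $1\le k\le k_{\max}$ (with $\log 0=-\infty$). Put $\hat F=\hat F^{\hat k}$, $\tilde X_J=(I-\hat F(\hat F^T\hat F)^{-1}\hat F^T)X_J$ and $\tilde\beta^0_J=(\tilde X_J^T\tilde X_J)^{-1}\tilde X_J^TY$. The eigenvectors and the minimiser may be any measurable choices. Let $w_J=Y-X_J\beta_J$ and $\tilde w_J=Y-X_J\tilde\beta_J^0$. **Lemma 1.** Assume (A), (B), (C). 1. If $\hat k=r$ with probability tending to one, then $\tilde w_J$ converges to $w_J$ in distribution as $n\to\infty$: for every $N$, the Lévy–Prokhorov distance between the laws of the first $N$ coordinates of $\tilde w_J$ and of $w_J$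 tends to $0$. 2. If, moreover, the idiosyncratic part contains no hidden factor, that is, $P(\|E\|^2\ge\kappa np)\to1$ for some $\kappa>0$ and $\|E\|_{op}^2=o_p\big((n+p)\log\frac{np}{n+p}\big)$, then $P(\hat k=r)\to1$, and hence $\tilde w_J$ converges to $w_J$ in distribution in the same sense. (In part 2 it is not assumed that $\hat k=r$ with probability tending to one.) -/

import Mathlib

open MeasureTheory Filter Topology Matrix

namespace FactorRegression

noncomputable section

/-! ## Generic notions -/

/-- Squared Frobenius norm. -/
def frobSq {ι κ : Type*} [Fintype ι] [Fintype κ] (A : Matrix ι κ ℝ) : ℝ :=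
  ∑ i, ∑ j, A i j ^ 2

/-- Spectral norm (operator norm between Euclidean spaces). -/
def specNorm {n p : ℕ} (A : Matrix (Fin n) (Fin p) ℝ) : ℝ :=
  ‖LinearMap.toContinuousLinearMap (Matrix.toEuclideanLin A)‖

/-- The expectation of `Z` exists, is finite and is at most `C`. -/
def ExpLE {Ω : Type*} [MeasurableSpace Ω] (μ : Measure Ω) (Z : Ω → ℝ) (C : ℝ) : Prop :=
  Integrable Z μ ∧ ∫ ω, Z ω ∂μ ≤ C

/-- `Z n = O_p(1)`. -/
def BoundedInProb {Ω : Type*} [MeasurableSpace Ω] (μ : Measure Ω) (Z : ℕ → Ω → ℝ) : Prop :=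
  ∀ η : ℝ, 0 < η → ∃ K : ℝ, ∀ᶠ n in atTop, μ {ω | K < |Z n ω|} ≤ ENNReal.ofReal η

/-- The matrix `F (Fᵀ F)⁻¹ Fᵀ`, the orthogonal projection onto the column space of `F` when `F` has
full column rank. -/
def projMat {n k : ℕ} (F : Matrix (Fin n) (Fin k) ℝ) : Matrix (Fin n) (Fin n) ℝ :=
  F * (Fᵀ * F)⁻¹ * Fᵀ

/-! ## Estimation of the factors and of their number -/

/-- `L` is `√p` times orthonormal eigenvectors of `Xᵀ X` belonging to its `k` largest eigenvalues:
`d` lists all eigenvalues in decreasing order and the columns of the orthogonal matrix `Q` are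
corresponding eigenvectors. -/
def IsLoadingEstimate {n p k : ℕ} (X : Matrix (Fin n) (Fin p) ℝ)
    (L : Matrix (Fin p) (Fin k) ℝ) : Prop :=
  ∃ (h : k ≤ p) (d : Fin p → ℝ) (Q : Matrix (Fin p) (Fin p) ℝ),
    Antitone d ∧ Qᵀ * Q = 1 ∧ (Xᵀ * X) * Q = Q * Matrix.diagonal d ∧
      ∀ i a, L i a = √(p : ℝ) * Q i (Fin.castLE h a)

/-- `Fhat = Fbar (Fbarᵀ Fbar / n)^{1/2}` where `Fbar = X L / p` for a loading estimate `L`; the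
square root is the positive semidefinite one. -/
def IsFactorEstimate {n p k : ℕ} (X : Matrix (Fin n) (Fin p) ℝ)
    (Fhat : Matrix (Fin n) (Fin k) ℝ) : Prop :=
  ∃ (L : Matrix (Fin p) (Fin k) ℝ) (Fbar : Matrix (Fin n) (Fin k) ℝ)
    (R : Matrix (Fin k) (Fin k) ℝ),
    IsLoadingEstimate X L ∧ Fbar = (1 / (p : ℝ)) • (X * L) ∧
      R.PosSemidef ∧ R * R = (1 / (n : ℝ)) • (Fbarᵀ * Fbar) ∧ Fhat = Fbar * R

/-- `V(k) = min_L ‖X - Fhat Lᵀ‖²`. -/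
def residualSS {n p k : ℕ} (X : Matrix (Fin n) (Fin p) ℝ) (Fhat : Matrix (Fin n) (Fin k) ℝ) : ℝ :=
  ⨅ L : Matrix (Fin p) (Fin k) ℝ, frobSq (X - Fhat * Lᵀ)

/-- `IC(k) = log V(k) + k ((n + p) / (n p)) log (n p / (n + p))`, with `log 0 = -∞`. -/
def infoCriterion {n p k : ℕ} (X : Matrix (Fin n) (Fin p) ℝ) (Fhat : Matrix (Fin n) (Fin k) ℝ) :
    EReal :=
  ENNReal.log (ENNReal.ofReal (residualSS X Fhat)) +
    (((k : ℝ) * (((n : ℝ) + p) / ((n : ℝ) * p)) *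
      Real.log (((n : ℝ) * p) / ((n : ℝ) + p)) : ℝ) : EReal)

/-- `Fhat 1, …, Fhat kmax` and `khat` are a possible output of the factor estimation procedure on
the input `X`: any choice of the eigenvectors and any minimiser of the criterion is allowed. -/
structure IsFactorSelection {n p : ℕ} (X : Matrix (Fin n) (Fin p) ℝ) (kmax : ℕ)
    (Fhat : (k : ℕ) → Matrix (Fin n) (Fin k) ℝ) (khat : ℕ) : Prop where
  factor : ∀ k, 1 ≤ k → k ≤ kmax → IsFactorEstimate X (Fhat k)
  one_le : 1 ≤ khat
  le_max : khat ≤ kmax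
  minimal : ∀ k, 1 ≤ k → k ≤ kmax → infoCriterion X (Fhat khat) ≤ infoCriterion X (Fhat k)

/-! ## The model -/

/-- The data of the regression model with `r` common factors, as an array indexed by the sample
size `n`: dimension `p n`, factors (row `t` of `F n ω` is `f_t`), loadings (row `j` of `Lam n` is
`λ_j`), idiosyncratic components `e_{tj}`, errors `ε_t`, coefficients `β_j`, and the (nonrandom)
set `J n` of selected variables. -/
structure Model (Ω : Type*) [MeasurableSpace Ω] (r : ℕ) where
  p : ℕ → ℕ
  F : (n : ℕ) → Ω → Matrix (Fin n) (Fin r) ℝ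
  Lam : (n : ℕ) → Matrix (Fin (p n)) (Fin r) ℝ
  E : (n : ℕ) → Ω → Matrix (Fin n) (Fin (p n)) ℝ
  err : (n : ℕ) → Ω → Fin n → ℝ
  β : (n : ℕ) → Fin (p n) → ℝ
  J : (n : ℕ) → Finset (Fin (p n))
  measurable_F : ∀ n t a, Measurable fun ω => F n ω t a
  measurable_E : ∀ n t j, Measurable fun ω => E n ω t j
  measurable_err : ∀ n t, Measurable fun ω => err n ω t

variable {Ω : Type*} [MeasurableSpace Ω] {r : ℕ}

namespace Model

/-- Number of selected variables. -/
def m (D : Model Ω r) (n : ℕ) : ℕ := (D.J n).card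

/-- `x_{tj} = λ_jᵀ f_t + e_{tj}`. -/
def X (D : Model Ω r) (n : ℕ) (ω : Ω) : Matrix (Fin n) (Fin (D.p n)) ℝ :=
  D.F n ω * (D.Lam n)ᵀ + D.E n ω

/-- `Y = X β + ε`. -/
def Y (D : Model Ω r) (n : ℕ) (ω : Ω) : Fin n → ℝ :=
  D.X n ω *ᵥ D.β n + D.err n ω

/-- The columns of `X` in `J`. -/
def XJ (D : Model Ω r) (n : ℕ) (ω : Ω) : Matrix (Fin n) (D.J n) ℝ :=
  (D.X n ω).submatrix id Subtype.val

/-- The columns of `E` in `J`. -/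
def EJ (D : Model Ω r) (n : ℕ) (ω : Ω) : Matrix (Fin n) (D.J n) ℝ :=
  (D.E n ω).submatrix id Subtype.val

/-- The entries of `β` in `J`. -/
def βJ (D : Model Ω r) (n : ℕ) : D.J n → ℝ := fun j => D.β n j

/-- The true residual `w_J = Y - X_J β_J`. -/
def wJ (D : Model Ω r) (n : ℕ) (ω : Ω) : Fin n → ℝ :=
  D.Y n ω - D.XJ n ω *ᵥ D.βJ n

/-- `X_J` with the estimated factors `Fhat` projected out. -/
def XtildeJ (D : Model Ω r) (n : ℕ) (ω : Ω) {k : ℕ} (Fhat : Matrix (Fin n) (Fin k) ℝ) :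
    Matrix (Fin n) (D.J n) ℝ :=
  (1 - projMat Fhat) * D.XJ n ω

/-- The estimator of `β_J` computed with the estimated factors `Fhat`. -/
def βtildeJ (D : Model Ω r) (n : ℕ) (ω : Ω) {k : ℕ} (Fhat : Matrix (Fin n) (Fin k) ℝ) :
    D.J n → ℝ :=
  ((D.XtildeJ n ω Fhat)ᵀ * D.XtildeJ n ω Fhat)⁻¹ *ᵥ ((D.XtildeJ n ω Fhat)ᵀ *ᵥ D.Y n ω)

/-- The estimated residual `Y - X_J β̃_J` computed with the estimated factors `Fhat`. -/
def wtildeJ (D : Model Ω r) (n : ℕ) (ω : Ω) {k : ℕ} (Fhat : Matrix (Fin n) (Fin k) ℝ) :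
    Fin n → ℝ :=
  D.Y n ω - D.XJ n ω *ᵥ D.βtildeJ n ω Fhat

/-- Growth of the dimensions, bounded coefficients, and errors with `n⁻¹ ∑ ε_t² = O_p(1)`. -/
structure DesignAssumptions (D : Model Ω r) (μ : Measure Ω) (M : ℝ) : Prop where
  p_growth : ∃ c : ℝ, 0 < c ∧ ∀ᶠ n : ℕ in atTop, c * n ≤ D.p n
  m_growth : Tendsto (fun n : ℕ => (D.m n : ℝ) ^ 2 / n) atTop (𝓝 0)
  coeff_bound : ∀ n, ∑ j, |D.β n j| ≤ M
  err_bound : BoundedInProb μ fun n ω => (1 / (n : ℝ)) * ∑ t, D.err n ω t ^ 2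

/-- Assumptions on factors, loadings, idiosyncratic components and their weak dependence. -/
structure FactorAssumptions (D : Model Ω r) (μ : Measure Ω) (M : ℝ) : Prop where
  /-- `E‖f_t‖⁴ < ∞` (for an array: bounded in `n` for each `t`). -/
  factor_moment : ∀ t : ℕ, ∃ C : ℝ, ∀ n (h : t < n),
    ExpLE μ (fun ω => (∑ a, D.F n ω ⟨t, h⟩ a ^ 2) ^ 2) C
  factor_cov : ∃ S : Matrix (Fin r) (Fin r) ℝ, S.PosDef ∧
    TendstoInMeasure μ (fun (n : ℕ) ω => frobSq ((1 / (n : ℝ)) • ((D.F n ω)ᵀ * D.F n ω) - S))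
      atTop fun _ => 0
  loading_bound : ∃ l : ℝ, ∀ n j, √(∑ a, D.Lam n j a ^ 2) ≤ l
  loading_cov : ∃ S : Matrix (Fin r) (Fin r) ℝ, S.PosDef ∧
    Tendsto (fun n : ℕ => frobSq ((1 / (D.p n : ℝ)) • ((D.Lam n)ᵀ * D.Lam n) - S)) atTop (𝓝 0)
  idio_mean : ∀ n t i, ∫ ω, D.E n ω t i ∂μ = 0
  idio_moment : ∀ n t i, ExpLE μ (fun ω => |D.E n ω t i| ^ 8) M
  /-- `γ(s,s)` is bounded by `M`, where `γ(s,t) = E(p⁻¹ ∑ᵢ e_{si} e_{ti})`. -/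
  idio_var : ∀ n s, |∫ ω, (1 / (D.p n : ℝ)) * ∑ i, D.E n ω s i * D.E n ω s i ∂μ| ≤ M
  idio_time_dep : ∀ n : ℕ, (1 / (n : ℝ)) *
    ∑ s, ∑ t, |∫ ω, (1 / (D.p n : ℝ)) * ∑ i, D.E n ω s i * D.E n ω t i ∂μ| ≤ M
  idio_cross_dep : ∀ n, ∃ τ : Fin (D.p n) → Fin (D.p n) → ℝ,
    (∀ t i j, |∫ ω, D.E n ω t i * D.E n ω t j ∂μ| ≤ |τ i j|) ∧
      (1 / (D.p n : ℝ)) * ∑ i, ∑ j, |τ i j| ≤ M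
  idio_joint_dep : ∀ n : ℕ, (1 / ((n : ℝ) * D.p n)) *
    ∑ i, ∑ j, ∑ t, ∑ s, |∫ ω, D.E n ω t i * D.E n ω s j ∂μ| ≤ M
  idio_fourth : ∀ n t s, ExpLE μ (fun ω => |(1 / √(D.p n : ℝ)) *
    ∑ i, (D.E n ω s i * D.E n ω t i - ∫ ω', D.E n ω' s i * D.E n ω' t i ∂μ)| ^ 4) M
  /-- `E(p⁻¹ ∑ᵢ ‖n^{-1/2} ∑ₜ f_t e_{ti}‖²) ≤ M`. -/
  weak_dep : ∀ n, ExpLE μ (fun ω => (1 / (D.p n : ℝ)) *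
    ∑ i, ∑ a, ((1 / √(n : ℝ)) * ∑ t, D.F n ω t a * D.E n ω t i) ^ 2) M

/-- Assumptions on the selected set. The limit matrix `G n` has the size of `J n`, which may grow;
positive definiteness of the limit is uniform in `n`. -/
structure SelectionAssumptions (D : Model Ω r) (μ : Measure Ω) (M : ℝ) : Prop where
  idio_cov : ∃ G : (n : ℕ) → Matrix (D.J n) (D.J n) ℝ,
    (∃ c : ℝ, 0 < c ∧ ∀ n, (G n - c • (1 : Matrix (D.J n) (D.J n) ℝ)).PosSemidef) ∧
    TendstoInMeasure μ (fun (n : ℕ) ω => frobSq ((1 / (n : ℝ)) • ((D.EJ n ω)ᵀ * D.EJ n ω) - G n))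
      atTop fun _ => 0
  factor_dep : ∀ n, ExpLE μ (fun ω => (1 / (D.m n : ℝ)) *
    ∑ j ∈ D.J n, ∑ a, ((1 / √(n : ℝ)) * ∑ t, D.F n ω t a * D.E n ω t j) ^ 2) M
  err_dep : ∀ n, ExpLE μ (fun ω => (1 / (D.m n : ℝ)) *
    ∑ j ∈ D.J n, ((1 / √(n : ℝ)) * ∑ t, D.err n ω t * D.E n ω t j) ^ 2) M
  idio_dep : ∀ n, ∀ i ∉ D.J n, ExpLE μ (fun ω => (1 / (D.m n : ℝ)) *
    ∑ j ∈ D.J n, ((1 / √(n : ℝ)) * ∑ t, D.E n ω t i * D.E n ω t j) ^ 2) M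

/-- The idiosyncratic part is not asymptotically negligible, and its squared spectral norm is of
smaller order than `(n + p) log (n p / (n + p))`, so that it contains no further factor. -/
structure NoHiddenFactor (D : Model Ω r) (μ : Measure Ω) : Prop where
  nondegenerate : ∃ κ : ℝ, 0 < κ ∧
    Tendsto (fun n : ℕ => μ {ω | frobSq (D.E n ω) < κ * (n * D.p n)}) atTop (𝓝 0)
  spectral : TendstoInMeasure μ (fun (n : ℕ) ω => specNorm (D.E n ω) ^ 2 /
    (((n : ℝ) + D.p n) * Real.log (((n : ℝ) * D.p n) / ((n : ℝ) + D.p n)))) atTop fun _ => 0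

end Model

/-! ## Convergence in distribution of vectors of growing length -/

/-- The first `N` coordinates of a vector (filled up with zeros when it is shorter). -/
def firstCoords (N : ℕ) {n : ℕ} (v : Fin n → ℝ) : Fin N → ℝ :=
  fun i => if h : (i : ℕ) < n then v ⟨i, h⟩ else 0

/-- The random vectors `U n` and `W n` of length `n` approach each other in distribution: for every
`N`, the Lévy–Prokhorov distance of the laws of their first `N` coordinates tends to `0`. If the
law of the first `N` coordinates of `W n` does not depend on `n`, this is convergence in
distribution of the first `N` coordinates of `U n` to it. -/
def ConvergesInDistribution (μ : Measure Ω) (U W : (n : ℕ) → Ω → Fin n → ℝ) : Prop :=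
  ∀ N : ℕ, Tendsto (fun n => levyProkhorovEDist
    (μ.map fun ω => firstCoords N (U n ω)) (μ.map fun ω => firstCoords N (W n ω))) atTop (𝓝 0)

end

end FactorRegression

/-! Write P for the orthogonal projection onto the columns of F and Q for the one onto the columns
of the estimated factors. By Eckart–Young (`residualSS_le_of_isFactorEstimate`, proved through Ky
Fan's inequality) these factors give a best rank-k fit of X for every choice of eigenvectors; the
deterministic bounds use no other property of them.

Suppose k = r. Comparing the fit with that of F itself gives ‖(1-Q)FΛᵀ‖² ≤ tr((Q-P)D) with D = XXᵀ -
FΛᵀΛFᵀ. Weak dependence makes ‖D‖ = O(p√n), while ‖Q-P‖² is O(‖(1-Q)F‖²/n), so the inequality closes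
on itself and yields ‖(1-Q)F‖² = O(1) and ‖QE_J‖² = O(m) (`FactorBounds.exists_proj`,
`SampleBounds.selectionBounds`). Hence the projected regressors are E_J plus a perturbation of
squared norm O(m). Their Gram matrix is of exact order n from below, and the normal equations give a
coefficient error of squared norm O(m/n) (`SelectionBounds.norm_coeff_error_sq_le`). One coordinate
of the residual sees this error through a row of X_J of squared norm O(m), so its squared error is
O(m²/n), which tends to 0 (`SampleBounds.residual_error_sq_le`). Coordinatewise closeness in
probability bounds the Lévy–Prokhorov distance.

For the number of factors, V(r) ≤ ‖E‖². With k < r factors, V(k) exceeds ‖E‖² by a multiple of np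
(`FactorBounds.residualSS_ge`), a constant gain in log V that the vanishing penalty cannot offset.
With k > r, V(k) is below ‖E‖² by at most 2·kmax·‖E‖_op² (`frobSq_sub_le_residualSS`), which without
a hidden factor is too little to pay for one more penalty term (`FactorBounds.khat_eq`).

The probabilistic part shows by moment bounds and Markov's inequality that all required sample
inequalities hold with one constant K outside an event of small probability; `EventuallyLikely` does
this bookkeeping. -/

namespace FactorRegression

/-! ### Frobenius norm, projections and the Eckart–Young theorem -/

section LinearAlgebra

attribute [local instance] Matrix.frobeniusNormedAddCommGroup Matrix.frobeniusNormedSpace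

variable {ι κ τ : Type*} [Fintype ι] [Fintype κ] [Fintype τ]

lemma norm_sq_eq_frobSq (A : Matrix ι κ ℝ) : ‖A‖ ^ 2 = frobSq A := by
  rw [Matrix.frobenius_norm_def, frobSq, ← Real.sqrt_eq_rpow, Real.sq_sqrt]
  · simp
  · positivity

lemma frobSq_eq_trace (A : Matrix ι κ ℝ) : frobSq A = (Aᵀ * A).trace := by
  simp only [frobSq, Matrix.trace, Matrix.diag, Matrix.mul_apply, Matrix.transpose_apply]
  rw [Finset.sum_comm]
  simp [sq]

lemma norm_sq_eq_trace (A : Matrix ι κ ℝ) : ‖A‖ ^ 2 = (Aᵀ * A).trace := by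
  rw [norm_sq_eq_frobSq, frobSq_eq_trace]

lemma norm_sq_eq_trace' (A : Matrix ι κ ℝ) : ‖A‖ ^ 2 = (A * Aᵀ).trace := by
  rw [norm_sq_eq_trace, Matrix.trace_mul_comm]

lemma abs_trace_mul_le (A : Matrix ι κ ℝ) (B : Matrix κ ι ℝ) :
    |(A * B).trace| ≤ ‖A‖ * ‖B‖ := by
  apply abs_le_of_sq_le_sq _ (by positivity)
  rw [mul_pow, ← Matrix.frobenius_norm_transpose B, norm_sq_eq_frobSq, norm_sq_eq_frobSq]
  have h := Finset.sum_mul_sq_le_sq_mul_sq (Finset.univ : Finset (ι × κ))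
    (fun x => A x.1 x.2) (fun x => Bᵀ x.1 x.2)
  simpa only [Fintype.sum_prod_type, frobSq, Matrix.trace, Matrix.diag, Matrix.mul_apply,
    Matrix.transpose_apply] using h

/-- An orthonormal basis of the column space of a matrix. -/
lemma exists_orthonormal_columns {n k : ℕ} (U : Matrix (Fin n) (Fin k) ℝ) :
    ∃ d ≤ k, ∃ (W : Matrix (Fin n) (Fin d) ℝ) (C : Matrix (Fin k) (Fin d) ℝ),
      Wᵀ * W = 1 ∧ W = U * C ∧ W * Wᵀ * U = U := by
  let u : Fin k → EuclideanSpace ℝ (Fin n) := fun a => WithLp.toLp 2 fun t => U t a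
  let S := Submodule.span ℝ (Set.range u)
  let b := stdOrthonormalBasis ℝ S
  have hspan : ∀ i, ∃ c : Fin k → ℝ, ∑ a, c a • u a = (b i : EuclideanSpace ℝ (Fin n)) :=
    fun i => (Submodule.mem_span_range_iff_exists_fun ℝ).1 (b i).2
  choose c hc using hspan
  let W : Matrix (Fin n) (Fin (Module.finrank ℝ S)) ℝ := fun t i => (b i : EuclideanSpace ℝ (Fin n)) t
  refine ⟨Module.finrank ℝ S, (finrank_range_le_card u).trans (by simp), W,
    Matrix.of fun a i => c i a,
    ?_, ?_, ?_⟩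
  · ext i j
    have h := orthonormal_iff_ite.1 b.orthonormal i j
    rw [Submodule.coe_inner, PiLp.inner_apply] at h
    simp only [Matrix.mul_apply, Matrix.transpose_apply, Matrix.one_apply]
    rw [← h]
    exact Finset.sum_congr rfl fun t _ => by simp [W, mul_comm]
  · ext t i
    have h := congrArg (fun v : EuclideanSpace ℝ (Fin n) => v t) (hc i)
    simp only [W]
    rw [← h]
    simp [u, mul_comm, Matrix.mul_apply]
  · ext t a
    have hu : u a ∈ S := Submodule.subset_span ⟨a, rfl⟩
    have h := congrArg (fun v : S => (v : EuclideanSpace ℝ (Fin n)) t) (b.sum_repr ⟨u a, hu⟩)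
    simp only [b.repr_apply_apply, Submodule.coe_inner, PiLp.inner_apply] at h
    have h' : U t a = u a t := rfl
    rw [h', ← h, Matrix.mul_assoc]
    simp only [Matrix.mul_apply, Matrix.transpose_apply]
    simp [W, u, mul_comm]

lemma transpose_self_mul_transpose {ι κ : Type*} [Fintype κ] (W : Matrix ι κ ℝ) : (W * Wᵀ)ᵀ = W * Wᵀ := by
  simp

lemma proj_mul_self [DecidableEq κ] {W : Matrix ι κ ℝ} (hW : Wᵀ * W = 1) : W * Wᵀ * (W * Wᵀ) = W * Wᵀ := by
  rw [Matrix.mul_assoc, ← Matrix.mul_assoc Wᵀ, hW, Matrix.one_mul]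

/-- The squared norm becomes linear in the projection, so two projections can be compared by taking
the trace of their difference against A Aᵀ. -/
lemma norm_sq_proj_mul {P : Matrix ι ι ℝ} (hs : Pᵀ = P) (hP : P * P = P) (A : Matrix ι τ ℝ) :
    ‖P * A‖ ^ 2 = (P * (A * Aᵀ)).trace := by
  rw [norm_sq_eq_trace', Matrix.transpose_mul, hs, Matrix.mul_assoc, ← Matrix.mul_assoc A,
    Matrix.trace_mul_comm, Matrix.mul_assoc, hP, Matrix.trace_mul_comm]

lemma compl_proj [DecidableEq ι] {P : Matrix ι ι ℝ} (hs : Pᵀ = P) (hP : P * P = P) :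
    (1 - P)ᵀ = 1 - P ∧ (1 - P) * (1 - P) = 1 - P := by
  constructor
  · simp [hs]
  · rw [Matrix.mul_sub, Matrix.sub_mul _ _ P, hP]
    simp

lemma norm_sq_proj_add [DecidableEq ι] {P : Matrix ι ι ℝ} (hs : Pᵀ = P) (hP : P * P = P) (A : Matrix ι τ ℝ) :
    ‖P * A‖ ^ 2 + ‖(1 - P) * A‖ ^ 2 = ‖A‖ ^ 2 := by
  rw [norm_sq_proj_mul hs hP, norm_sq_proj_mul (compl_proj hs hP).1 (compl_proj hs hP).2,
    ← Matrix.trace_add, ← Matrix.add_mul, norm_sq_eq_trace']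
  simp

lemma norm_proj_mul_le [DecidableEq ι] {P : Matrix ι ι ℝ} (hs : Pᵀ = P) (hP : P * P = P) (A : Matrix ι τ ℝ) :
    ‖P * A‖ ≤ ‖A‖ := by
  apply le_of_sq_le_sq _ (norm_nonneg _)
  nlinarith [norm_sq_proj_add hs hP A, sq_nonneg ‖(1 - P) * A‖]

lemma norm_compl_proj_mul_le [DecidableEq ι] {P : Matrix ι ι ℝ} (hs : Pᵀ = P) (hP : P * P = P)
    (A : Matrix ι τ ℝ) : ‖(1 - P) * A‖ ≤ ‖A‖ :=
  norm_proj_mul_le (compl_proj hs hP).1 (compl_proj hs hP).2 A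

lemma norm_orthonormal_mul [DecidableEq κ] {W : Matrix ι κ ℝ} (hW : Wᵀ * W = 1) (A : Matrix κ τ ℝ) :
    ‖W * A‖ = ‖A‖ := by
  have : ‖W * A‖ ^ 2 = ‖A‖ ^ 2 := by
    rw [norm_sq_eq_trace, norm_sq_eq_trace, Matrix.transpose_mul, Matrix.mul_assoc,
      ← Matrix.mul_assoc Wᵀ, hW, Matrix.one_mul]
  exact (sq_eq_sq₀ (norm_nonneg _) (norm_nonneg _)).1 this

lemma norm_sq_orthonormal [DecidableEq κ] {W : Matrix ι κ ℝ} (hW : Wᵀ * W = 1) :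
    ‖W‖ ^ 2 = Fintype.card κ := by
  rw [norm_sq_eq_trace, hW, Matrix.trace_one]

/-- If the columns of `W` are an orthonormal basis of the column space of `U` and there are as many
as in `U`, then `Uᵀ U` is invertible and `projMat U` is the projection `W Wᵀ`. -/
lemma projMat_eq {n k : ℕ} {U W : Matrix (Fin n) (Fin k) ℝ} {C : Matrix (Fin k) (Fin k) ℝ}
    (hW : Wᵀ * W = 1) (hC : W = U * C) : projMat U = W * Wᵀ := by
  have h1 : Cᵀ * (Uᵀ * U * C) = 1 := by
    rw [← hW, hC, Matrix.transpose_mul]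
    simp only [Matrix.mul_assoc]
  have h2 : Uᵀ * U * (C * Cᵀ) = 1 := by
    rw [← Matrix.mul_assoc]
    exact mul_eq_one_comm.1 h1
  rw [projMat, Matrix.inv_eq_right_inv h2, hC, Matrix.transpose_mul]
  simp only [Matrix.mul_assoc]

/-- Abel-type bound behind Ky Fan's inequality. -/
lemma sum_mul_le_sum_head {p k : ℕ} (h : k ≤ p) {d c : Fin p → ℝ} (hd : Antitone d)
    (hd0 : ∀ i, 0 ≤ d i) (hc0 : ∀ i, 0 ≤ c i) (hc1 : ∀ i, c i ≤ 1) (hc : ∑ i, c i ≤ k) :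
    ∑ i, d i * c i ≤ ∑ a : Fin k, d (Fin.castLE h a) := by
  have hhead : ∀ f : Fin p → ℝ,
      ∑ a : Fin k, f (Fin.castLE h a) = ∑ i : Fin p, if (i : ℕ) < k then f i else 0 := by
    intro f
    rw [← Finset.sum_filter]
    refine Finset.sum_bij (fun a _ => Fin.castLE h a) (by simp) (by simp) ?_ (by simp)
    intro i hi
    exact ⟨⟨i, (Finset.mem_filter.1 hi).2⟩, by simp, by ext; simp⟩
  -- The threshold is the first eigenvalue left out, or 0 when k = p, where nonnegativity of d is
  -- enough. Then d i - θ and c i - 1_{i<k} have opposite signs for every i.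
  let θ : ℝ := if hk : k < p then d ⟨k, hk⟩ else 0
  have hθ : 0 ≤ θ := by
    by_cases hk : k < p <;> simp [θ, hk, hd0]
  have key : ∀ i, d i * c i - (if (i : ℕ) < k then d i else 0)
      ≤ θ * (c i - if (i : ℕ) < k then 1 else 0) := by
    intro i
    by_cases hi : (i : ℕ) < k
    · have : θ ≤ d i := by
        by_cases hk : k < p
        · simp only [θ, hk, dif_pos]
          exact hd (Fin.le_def.2 hi.le)
        · simp [θ, hk, hd0]
      simp only [hi, if_true]
      nlinarith [hc1 i]
    · have hk : k < p := lt_of_le_of_lt (not_lt.1 hi) i.2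
      have : d i ≤ θ := by
        simp only [θ, hk, dif_pos]
        exact hd (Fin.le_def.2 (not_lt.1 hi))
      simp only [hi, if_false, sub_zero]
      nlinarith [hc0 i]
  have hsum := Finset.sum_le_sum fun i (_ : i ∈ Finset.univ) => key i
  rw [← Finset.mul_sum, Finset.sum_sub_distrib, Finset.sum_sub_distrib, ← hhead d,
    ← hhead fun _ => 1] at hsum
  simp only [Finset.sum_const, Finset.card_univ, Fintype.card_fin, nsmul_eq_mul, mul_one] at hsum
  nlinarith

/-- Ky Fan's inequality for a positive semidefinite matrix given by its spectral decomposition. -/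
lemma trace_transpose_mul_mul_le {p k d' : ℕ} (h : k ≤ p) (hd' : d' ≤ k)
    {B Q : Matrix (Fin p) (Fin p) ℝ} {d : Fin p → ℝ} (hd : Antitone d) (hd0 : ∀ i, 0 ≤ d i)
    (hQ : Qᵀ * Q = 1) (hB : B * Q = Q * Matrix.diagonal d) {W : Matrix (Fin p) (Fin d') ℝ}
    (hW : Wᵀ * W = 1) : (Wᵀ * B * W).trace ≤ ∑ a : Fin k, d (Fin.castLE h a) := by
  have hQ' : Q * Qᵀ = 1 := mul_eq_one_comm.1 hQ
  set V := Qᵀ * W with hVdef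
  have hV : Vᵀ * V = 1 := by
    rw [hVdef, Matrix.transpose_mul, Matrix.transpose_transpose, Matrix.mul_assoc,
      ← Matrix.mul_assoc Q, hQ', Matrix.one_mul, hW]
  have hBV : Wᵀ * B * W = Vᵀ * Matrix.diagonal d * V := by
    have : B = Q * Matrix.diagonal d * Qᵀ := by
      rw [← hB, Matrix.mul_assoc, hQ', Matrix.mul_one]
    rw [this, hVdef, Matrix.transpose_mul, Matrix.transpose_transpose]
    simp only [Matrix.mul_assoc]
  have htr : (Wᵀ * B * W).trace = ∑ i, d i * (V * Vᵀ) i i := by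
    rw [hBV, Matrix.mul_assoc, Matrix.trace_mul_comm, Matrix.mul_assoc]
    simp [Matrix.trace, Matrix.diagonal_mul]
  rw [htr]
  -- A diagonal entry of a projection is the sum of squares of its row; this puts the weights in [0,
  -- 1], and their sum is the rank d' ≤ k.
  have hdiag : ∀ i, (V * Vᵀ) i i = ∑ j, (V * Vᵀ) i j ^ 2 := by
    intro i
    conv_lhs => rw [← proj_mul_self hV]
    rw [Matrix.mul_apply]
    refine Finset.sum_congr rfl fun j _ => ?_
    rw [sq, ← Matrix.transpose_apply (V * Vᵀ) i j, transpose_self_mul_transpose]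
  have h0 : ∀ i, 0 ≤ (V * Vᵀ) i i := fun i => by rw [hdiag]; positivity
  refine sum_mul_le_sum_head h hd hd0 h0 (fun i => ?_) ?_
  · have : (V * Vᵀ) i i ^ 2 ≤ (V * Vᵀ) i i := by
      conv_rhs => rw [hdiag]
      exact Finset.single_le_sum (f := fun j => (V * Vᵀ) i j ^ 2) (fun _ _ => sq_nonneg _)
        (Finset.mem_univ i)
    nlinarith [h0 i]
  · have : ∑ i, (V * Vᵀ) i i = (V * Vᵀ).trace := rfl
    rw [this, Matrix.trace_mul_comm, hV, Matrix.trace_one]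
    simpa using hd'

/-- A symmetric matrix `R` with `R² = c Aᵀ A` can be cancelled on the right of `A`. -/
lemma exists_mul_eq_of_sq {k : ℕ} {A : Matrix ι (Fin k) ℝ} {R : Matrix (Fin k) (Fin k) ℝ}
    {c : ℝ} (hc : c ≠ 0) (hs : Rᵀ = R) (hR : R * R = c • (Aᵀ * A)) :
    ∃ S : Matrix (Fin k) (Fin k) ℝ, A * R * S = A := by
  obtain ⟨d, -, W, C, -, hWC, hWR⟩ := exists_orthonormal_columns R
  -- R may be singular. Since 1 - W Wᵀ maps into the kernel of R and R² is a nonzero multiple of Aᵀ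
  -- A, it also maps into the kernel of A, so R need only be inverted on its range; C Wᵀ does this.
  have hRN : R * (1 - W * Wᵀ) = 0 := by
    have := congrArg Matrix.transpose hWR
    rw [Matrix.transpose_mul, transpose_self_mul_transpose, hs] at this
    rw [Matrix.mul_sub, this, Matrix.mul_one, sub_self]
  have hAN : A * (1 - W * Wᵀ) = 0 := by
    have h : c * ‖A * (1 - W * Wᵀ)‖ ^ 2 = 0 := by
      rw [norm_sq_eq_trace, ← smul_eq_mul, ← Matrix.trace_smul, Matrix.transpose_mul,
        Matrix.mul_assoc, ← Matrix.mul_assoc Aᵀ, ← Matrix.mul_smul, ← Matrix.smul_mul, ← hR,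
        Matrix.mul_assoc R, hRN]
      simp
    have := (mul_eq_zero.1 h).resolve_left hc
    exact norm_eq_zero.1 (pow_eq_zero_iff two_ne_zero |>.1 this)
  refine ⟨C * Wᵀ, ?_⟩
  rw [Matrix.mul_assoc, ← Matrix.mul_assoc R, ← hWC]
  rw [Matrix.mul_sub, Matrix.mul_one, sub_eq_zero] at hAN
  exact hAN.symm

lemma residualSS_le {n p k : ℕ} (X : Matrix (Fin n) (Fin p) ℝ) (Fh : Matrix (Fin n) (Fin k) ℝ)
    (L : Matrix (Fin p) (Fin k) ℝ) : residualSS X Fh ≤ frobSq (X - Fh * Lᵀ) :=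
  ciInf_le ⟨0, by rintro _ ⟨L, rfl⟩; exact (sq_nonneg _).trans_eq (norm_sq_eq_frobSq (X - Fh * Lᵀ))⟩ L

/-- Eckart–Young: the estimated factors minimise the residual sum of squares among all
decompositions of the same rank. -/
lemma residualSS_le_of_isFactorEstimate {n p k : ℕ} (hn : n ≠ 0) (hp : p ≠ 0)
    {X : Matrix (Fin n) (Fin p) ℝ} {Fh : Matrix (Fin n) (Fin k) ℝ} (hF : IsFactorEstimate X Fh)
    (U : Matrix (Fin n) (Fin k) ℝ) (L : Matrix (Fin p) (Fin k) ℝ) :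
    residualSS X Fh ≤ frobSq (X - U * Lᵀ) := by
  obtain ⟨Lh, Fbar, R, ⟨hk, d, Q, hd, hQ, hB, hL⟩, hFbar, hRpos, hRR, rfl⟩ := hF
  have hRs : Rᵀ = R := by simpa using hRpos.isHermitian.eq
  obtain ⟨S, hS⟩ := exists_mul_eq_of_sq (by positivity) hRs hRR
  have hp' : (0 : ℝ) < p := by positivity
  set Qk : Matrix (Fin p) (Fin k) ℝ := Q.submatrix id (Fin.castLE hk) with hQk
  have hLQ : Lh = √(p : ℝ) • Qk := by
    ext i a
    simp [hL, hQk]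
  have hQQ : Qkᵀ * Qk = 1 := by
    rw [hQk, Matrix.transpose_submatrix, ← Matrix.submatrix_mul _ _ _ id _ Function.bijective_id, hQ]
    ext a b
    simp [Matrix.one_apply]
  have hBQ : Xᵀ * X * Qk = Qk * Matrix.diagonal fun a => d (Fin.castLE hk a) := by
    ext i a
    have := congrFun (congrFun hB i) (Fin.castLE hk a)
    rw [Matrix.mul_diagonal] at this
    rw [Matrix.mul_diagonal]
    exact this
  have hd0 : ∀ i, 0 ≤ d i := by
    intro i
    have h1 : (Qᵀ * (Xᵀ * X) * Q) i i = d i := by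
      rw [Matrix.mul_assoc, hB, ← Matrix.mul_assoc, hQ, Matrix.one_mul, Matrix.diagonal_apply_eq]
    have h2 : Qᵀ * (Xᵀ * X) * Q = (X * Q)ᵀ * (X * Q) := by
      rw [Matrix.transpose_mul]
      simp only [Matrix.mul_assoc]
    rw [← h1, h2, Matrix.mul_apply]
    exact Finset.sum_nonneg fun j _ => mul_self_nonneg _
  have hsplit : ∀ {e : ℕ} (W : Matrix (Fin p) (Fin e) ℝ), Wᵀ * W = 1 →
      ‖X * (1 - W * Wᵀ)‖ ^ 2 = (Xᵀ * X).trace - (Wᵀ * (Xᵀ * X) * W).trace := by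
    intro e W hW
    obtain ⟨hs, hi⟩ := compl_proj (transpose_self_mul_transpose W) (proj_mul_self hW)
    have := norm_sq_proj_mul hs hi Xᵀ
    rw [← Matrix.frobenius_norm_transpose, Matrix.transpose_mul, hs, this,
      Matrix.transpose_transpose, Matrix.sub_mul, Matrix.one_mul, Matrix.trace_sub,
      Matrix.mul_assoc W, Matrix.trace_mul_comm W]
  have hupper : residualSS X (Fbar * R) ≤ ‖X * (1 - Qk * Qkᵀ)‖ ^ 2 := by
    rw [norm_sq_eq_frobSq]
    -- With this loading matrix the fit is X Qk Qkᵀ: S undoes the normalisation R, and the factors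
    -- √p cancel 1/p.
    convert residualSS_le X (Fbar * R) (√(p : ℝ) • (Qk * Sᵀ)) using 2
    rw [Matrix.transpose_smul, Matrix.transpose_mul, Matrix.transpose_transpose, Matrix.mul_smul,
      ← Matrix.mul_assoc, hS, hFbar, hLQ]
    simp only [Matrix.mul_smul, Matrix.smul_mul, smul_smul, Matrix.mul_sub, Matrix.mul_one,
      ← Matrix.mul_assoc]
    have : √(p : ℝ) * (1 / (p : ℝ) * √(p : ℝ)) = 1 := by
      have := Real.mul_self_sqrt hp'.le
      field_simp
      nlinarith
    rw [this, one_smul]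
  obtain ⟨e, he, W, C, hW, -, hWL⟩ := exists_orthonormal_columns L
  have hlower : ‖X * (1 - W * Wᵀ)‖ ^ 2 ≤ frobSq (X - U * Lᵀ) := by
    rw [← norm_sq_eq_frobSq]
    have hs := transpose_self_mul_transpose W
    have h1 : X * (1 - W * Wᵀ) = (X - U * Lᵀ) * (1 - W * Wᵀ) := by
      have : Lᵀ * (1 - W * Wᵀ) = 0 := by
        have := congrArg Matrix.transpose hWL
        rw [Matrix.transpose_mul, hs] at this
        rw [Matrix.mul_sub, this, Matrix.mul_one, sub_self]
      rw [Matrix.sub_mul X, Matrix.mul_assoc U, this, Matrix.mul_zero, sub_zero]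
    rw [h1]
    gcongr 1
    rw [← Matrix.frobenius_norm_transpose, ← Matrix.frobenius_norm_transpose (X - U * Lᵀ),
      Matrix.transpose_mul, (compl_proj hs (proj_mul_self hW)).1]
    exact norm_compl_proj_mul_le hs (proj_mul_self hW) _
  refine hupper.trans (le_trans ?_ hlower)
  rw [hsplit Qk hQQ, hsplit W hW]
  have h1 := trace_transpose_mul_mul_le hk he hd hd0 hQ hB hW
  have h2 : (Qkᵀ * (Xᵀ * X) * Qk).trace = ∑ a : Fin k, d (Fin.castLE hk a) := by
    rw [Matrix.mul_assoc, hBQ, ← Matrix.mul_assoc, hQQ, Matrix.one_mul, Matrix.trace_diagonal]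
  linarith

end LinearAlgebra

/-! ### Recovery of the factor space and underfitting -/

section Deterministic

attribute [local instance] Matrix.frobeniusNormedAddCommGroup Matrix.frobeniusNormedSpace

lemma norm_add_sq_le_two {V : Type*} [SeminormedAddCommGroup V] (a b : V) :
    ‖a + b‖ ^ 2 ≤ 2 * (‖a‖ ^ 2 + ‖b‖ ^ 2) := by
  have h := norm_add_le a b
  have h0 := norm_nonneg (a + b)
  nlinarith [sq_nonneg (‖a‖ - ‖b‖)]

lemma norm_mul_sq_le {ι κ τ : Type*} [Fintype ι] [Fintype κ] [Fintype τ] (A : Matrix ι κ ℝ)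
    (B : Matrix κ τ ℝ) : ‖A * B‖ ^ 2 ≤ ‖A‖ ^ 2 * ‖B‖ ^ 2 := by
  rw [← mul_pow]
  gcongr
  exact Matrix.frobenius_norm_mul A B

/-- Bounds on factors, loadings and idiosyncratic components, with one constant `K`. -/
structure FactorBounds (K : ℝ) {n p r : ℕ} (F : Matrix (Fin n) (Fin r) ℝ)
    (Lam : Matrix (Fin p) (Fin r) ℝ) (E : Matrix (Fin n) (Fin p) ℝ) : Prop where
  one_le : 1 ≤ K
  dim_le : (n : ℝ) ≤ K * p
  factor_le : ‖F‖ ^ 2 ≤ K * n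
  factor_ge : ∀ {q : ℕ} (V : Matrix (Fin r) (Fin q) ℝ), n * ‖V‖ ^ 2 ≤ K * ‖F * V‖ ^ 2
  loading_ge : ∀ {q : ℕ} (V : Matrix (Fin r) (Fin q) ℝ), p * ‖V‖ ^ 2 ≤ K * ‖Lam * V‖ ^ 2
  idio_loading : ‖E * Lam‖ ^ 2 ≤ K * (n * p)
  idio_gram : ‖E * Eᵀ‖ ^ 2 ≤ K * (p ^ 2 * n)

variable {n p r : ℕ} {K : ℝ} {F : Matrix (Fin n) (Fin r) ℝ} {Lam : Matrix (Fin p) (Fin r) ℝ}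
  {E : Matrix (Fin n) (Fin p) ℝ}

/-- The product of the two bounds is of order n²p; `dim_le` trades one n for p, so that the cross
term has the order p²n of the bound for E Eᵀ. -/
lemma FactorBounds.norm_factor_mul_idio_sq_le (h : FactorBounds K F Lam E) :
    (‖F‖ * ‖E * Lam‖) ^ 2 ≤ K ^ 3 * (p ^ 2 * n) := by
  have hK := h.one_le
  rw [mul_pow]
  calc ‖F‖ ^ 2 * ‖E * Lam‖ ^ 2 ≤ (K * n) * (K * (n * p)) := by
        gcongr
        · exact h.factor_le
        · exact h.idio_loading
    _ = K ^ 2 * (n * p) * n := by ring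
    _ ≤ K ^ 2 * (n * p) * (K * p) := by gcongr; exact h.dim_le
    _ = _ := by ring

/-- The difference between `X Xᵀ` and its low-rank part. -/
lemma FactorBounds.norm_gram_sub_sq_le (h : FactorBounds K F Lam E) :
    ‖(F * Lamᵀ + E) * (F * Lamᵀ + E)ᵀ - (F * Lamᵀ) * (F * Lamᵀ)ᵀ‖ ^ 2
      ≤ 10 * K ^ 3 * (p ^ 2 * n) := by
  have hK := h.one_le
  set Z := F * (E * Lam)ᵀ with hZ
  have hZle : ‖Z‖ ^ 2 ≤ K ^ 3 * (p ^ 2 * n) := by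
    refine le_trans ?_ h.norm_factor_mul_idio_sq_le
    gcongr
    rw [← Matrix.frobenius_norm_transpose (E * Lam)]
    exact Matrix.frobenius_norm_mul _ _
  have hD : (F * Lamᵀ + E) * (F * Lamᵀ + E)ᵀ - (F * Lamᵀ) * (F * Lamᵀ)ᵀ
      = (Z + Zᵀ) + E * Eᵀ := by
    rw [hZ, Matrix.transpose_mul, Matrix.transpose_transpose, Matrix.transpose_add,
      Matrix.transpose_mul, Matrix.transpose_transpose, Matrix.transpose_mul, Matrix.add_mul,
      Matrix.mul_add, Matrix.mul_add]
    simp only [Matrix.mul_assoc, Matrix.transpose_mul, Matrix.transpose_transpose]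
    abel
  rw [hD]
  -- The two doublings cost 2(4 + 1) = 10.
  have h1 := norm_add_sq_le_two (Z + Zᵀ) (E * Eᵀ)
  have h2 := norm_add_sq_le_two Z Zᵀ
  rw [Matrix.frobenius_norm_transpose] at h2
  have h3 := h.idio_gram
  have h4 : K * (p ^ 2 * n : ℝ) ≤ K ^ 3 * (p ^ 2 * n) := by
    gcongr
    exact le_self_pow₀ hK (by norm_num)
  nlinarith

/-- An orthonormal basis of the column space of the factors, with a bound on the coefficients. -/
lemma FactorBounds.exists_basis (h : FactorBounds K F Lam E) (hn : 0 < n) :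
    ∃ (W : Matrix (Fin n) (Fin r) ℝ) (C : Matrix (Fin r) (Fin r) ℝ),
      Wᵀ * W = 1 ∧ W = F * C ∧ W * Wᵀ * F = F ∧ n * ‖C‖ ^ 2 ≤ K * r := by
  obtain ⟨d, hd, W, C, hW, hWC, hWF⟩ := exists_orthonormal_columns F
  have hn' : (0 : ℝ) < n := by positivity
  have hdr : d = r := by
    refine le_antisymm hd ?_
    -- the map `v ↦ Wᵀ F v` is injective
    by_contra hlt
    have hcard : d < r := not_le.1 hlt
    obtain ⟨v, hv0, hv⟩ : ∃ v : Fin r → ℝ, v ≠ 0 ∧ (Wᵀ * F) *ᵥ v = 0 := by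
      have : ¬ Function.Injective (Matrix.mulVecLin (Wᵀ * F)) := by
        intro hinj
        have := LinearMap.finrank_le_finrank_of_injective hinj
        simp at this
        omega
      rw [← LinearMap.ker_eq_bot, Submodule.eq_bot_iff] at this
      push Not at this
      obtain ⟨v, hv, hv0⟩ := this
      exact ⟨v, hv0, by simpa only [Matrix.mulVecLin_apply, LinearMap.mem_ker] using hv⟩
    have hFv : F * Matrix.replicateCol (Fin 1) v = 0 := by
      rw [← hWF, Matrix.mul_assoc, Matrix.mul_assoc, ← Matrix.mul_assoc Wᵀ,
        ← Matrix.replicateCol_mulVec, hv]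
      ext
      simp [Matrix.mul_apply]
    have := h.factor_ge (Matrix.replicateCol (Fin 1) v)
    rw [hFv, norm_zero] at this
    have h0 : ‖Matrix.replicateCol (Fin 1) v‖ ^ 2 ≤ 0 := by
      by_contra hpos
      nlinarith [mul_pos hn' (not_le.1 hpos)]
    have h1 : Matrix.replicateCol (Fin 1) v = 0 := by
      rw [← norm_eq_zero]
      nlinarith [norm_nonneg (Matrix.replicateCol (Fin 1) v)]
    apply hv0
    ext a
    exact congrFun (congrFun h1 a) 0
  subst hdr
  refine ⟨W, C, hW, hWC, hWF, ?_⟩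
  -- Since F C = W has squared norm r, the lower bound for F becomes an upper bound for C.
  have := h.factor_ge C
  rwa [← hWC, norm_sq_orthonormal hW, Fintype.card_fin] at this

lemma FactorBounds.loading_ge' (h : FactorBounds K F Lam E) {q : ℕ} (A : Matrix (Fin q) (Fin r) ℝ) :
    p * ‖A‖ ^ 2 ≤ K * ‖A * Lamᵀ‖ ^ 2 := by
  have := h.loading_ge Aᵀ
  rwa [Matrix.frobenius_norm_transpose, ← Matrix.frobenius_norm_transpose (Lam * Aᵀ),
    Matrix.transpose_mul, Matrix.transpose_transpose] at this

/-- A factor estimate attaining the best rank-`r` approximation spans nearly the same space as the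
factors. -/
lemma FactorBounds.exists_proj (h : FactorBounds K F Lam E) (hn : 0 < n) (hp : 0 < p)
    (hlarge : 20 * K ^ 7 * r ^ 2 < n) {Fh : Matrix (Fin n) (Fin r) ℝ}
    (hopt : ∀ (U : Matrix (Fin n) (Fin r) ℝ) (L : Matrix (Fin p) (Fin r) ℝ),
      residualSS (F * Lamᵀ + E) Fh ≤ frobSq (F * Lamᵀ + E - U * Lᵀ)) :
    (projMat Fh)ᵀ = projMat Fh ∧ projMat Fh * projMat Fh = projMat Fh ∧
      ‖(1 - projMat Fh) * F‖ ^ 2 ≤ 20 * K ^ 6 * r ∧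
      ∀ {ι : Type} [Fintype ι] (A : Matrix (Fin n) ι ℝ),
        n * ‖projMat Fh * A‖ ^ 2 ≤ 2 * (K * r) * (20 * K ^ 6 * r * ‖A‖ ^ 2 + ‖Fᵀ * A‖ ^ 2) := by
  have hK := h.one_le
  have hn' : (0 : ℝ) < n := by positivity
  have hp' : (0 : ℝ) < p := by positivity
  obtain ⟨W, C, hW, hWC, hWF, hC⟩ := h.exists_basis hn
  obtain ⟨d, hd, Wh, Ch, hWh, hWCh, hWhF⟩ := exists_orthonormal_columns Fh
  set X := F * Lamᵀ + E with hX
  set D := X * Xᵀ - (F * Lamᵀ) * (F * Lamᵀ)ᵀ with hD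
  have hDle : ‖D‖ ^ 2 ≤ 10 * K ^ 3 * (p ^ 2 * n) := h.norm_gram_sub_sq_le
  set P := W * Wᵀ with hP
  set Q := Wh * Whᵀ with hQ
  have hPs : Pᵀ = P := transpose_self_mul_transpose W
  have hPP : P * P = P := proj_mul_self hW
  have hQs : Qᵀ = Q := transpose_self_mul_transpose Wh
  have hQQ : Q * Q = Q := proj_mul_self hWh
  obtain ⟨hQs', hQQ'⟩ := compl_proj hQs hQQ
  obtain ⟨hPs', hPP'⟩ := compl_proj hPs hPP
  have htrP : P.trace = r := by
    rw [hP, Matrix.trace_mul_comm, hW, Matrix.trace_one, Fintype.card_fin]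
  have htrQ : Q.trace = d := by
    rw [hQ, Matrix.trace_mul_comm, hWh, Matrix.trace_one, Fintype.card_fin]
  set s := ‖(1 - Q) * W‖ ^ 2 with hs
  have hs_eq : s = r - (Q * P).trace := by
    rw [hs, norm_sq_proj_mul hQs' hQQ', ← hP, Matrix.sub_mul, Matrix.trace_sub, Matrix.one_mul, htrP]
  have hs_le : n * s ≤ K * r * ‖(1 - Q) * F‖ ^ 2 := by
    have h1 : s ≤ ‖(1 - Q) * F‖ ^ 2 * ‖C‖ ^ 2 := by
      have h2 := norm_mul_sq_le ((1 - Q) * F) C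
      rwa [Matrix.mul_assoc, ← hWC] at h2
    calc n * s ≤ n * (‖(1 - Q) * F‖ ^ 2 * ‖C‖ ^ 2) := by gcongr
      _ = ‖(1 - Q) * F‖ ^ 2 * (n * ‖C‖ ^ 2) := by ring
      _ ≤ ‖(1 - Q) * F‖ ^ 2 * (K * r) := by gcongr
      _ = _ := by ring
  have hdr : (d : ℝ) ≤ r := by exact_mod_cast hd
  -- The left side is d + r - 2 tr(QP), and d ≤ r.
  have hQP : ‖Q - P‖ ^ 2 ≤ 2 * s := by
    rw [norm_sq_eq_trace, Matrix.transpose_sub, hQs, hPs, Matrix.sub_mul, Matrix.mul_sub,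
      Matrix.mul_sub, hQQ, hPP, Matrix.trace_sub, Matrix.trace_sub, Matrix.trace_sub, htrP, htrQ,
      Matrix.trace_mul_comm P Q]
    linarith
  have hres : ‖(1 - Q) * X‖ ^ 2 ≤ ‖(1 - P) * X‖ ^ 2 := by
    -- The competitor F C Wᵀ X equals P X, the best fit of X by the columns of F.
    have h1 : ‖(1 - P) * X‖ ^ 2 = frobSq (X - F * ((C * Wᵀ * X)ᵀ)ᵀ) := by
      rw [norm_sq_eq_frobSq, Matrix.transpose_transpose, Matrix.sub_mul, Matrix.one_mul, hP]
      nth_rw 1 [hWC]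
      simp only [Matrix.mul_assoc]
    rw [h1]
    refine le_trans ?_ (hopt F _)
    refine le_ciInf fun L => ?_
    rw [← norm_sq_eq_frobSq]
    gcongr 1
    have h2 : (1 - Q) * X = (1 - Q) * (X - Fh * Lᵀ) := by
      have : (1 - Q) * Fh = 0 := by rw [Matrix.sub_mul, hWhF, Matrix.one_mul, sub_self]
      rw [Matrix.mul_sub, ← Matrix.mul_assoc, this, Matrix.zero_mul, sub_zero]
    rw [h2]
    exact norm_compl_proj_mul_le hQs hQQ _
  have hXX : X * Xᵀ = (F * Lamᵀ) * (F * Lamᵀ)ᵀ + D := by rw [hD]; abel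
  have htr : ‖(1 - Q) * (F * Lamᵀ)‖ ^ 2 ≤ ‖Q - P‖ * ‖D‖ := by
    have hPF : (1 - P) * (F * Lamᵀ) = 0 := by
      rw [← Matrix.mul_assoc, Matrix.sub_mul, hWF, Matrix.one_mul, sub_self, Matrix.zero_mul]
    have h3 : ((1 - P) * ((F * Lamᵀ) * (F * Lamᵀ)ᵀ)).trace = 0 := by
      rw [← Matrix.mul_assoc, hPF]
      simp
    rw [norm_sq_proj_mul hQs' hQQ', norm_sq_proj_mul hPs' hPP', hXX, Matrix.mul_add, Matrix.mul_add,
      Matrix.trace_add, Matrix.trace_add, h3] at hres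
    rw [norm_sq_proj_mul hQs' hQQ']
    have h4 := (le_abs_self _).trans (abs_trace_mul_le (Q - P) D)
    have h5 : ((Q - P) * D).trace = ((1 - P) * D).trace - ((1 - Q) * D).trace := by
      rw [← Matrix.trace_sub, ← Matrix.sub_mul]
      congr 2
      abel
    linarith
  set x := ‖(1 - Q) * F‖ ^ 2 with hx
  have hx0 : 0 ≤ x := by positivity
  have hpx : p * x ≤ K * (‖Q - P‖ * ‖D‖) := by
    refine (h.loading_ge' ((1 - Q) * F)).trans ?_
    rw [Matrix.mul_assoc]
    gcongr
  -- The bound is self-improving: x² is controlled by n s, and n s by x, so one factor x cancels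
  -- unless x = 0.
  have hxle : x ≤ 20 * K ^ 6 * r := by
    have h6 : (p * x) ^ 2 ≤ K ^ 2 * ((2 * s) * (10 * K ^ 3 * (p ^ 2 * n))) := by
      calc (p * x) ^ 2 ≤ (K * (‖Q - P‖ * ‖D‖)) ^ 2 := by gcongr
        _ = K ^ 2 * (‖Q - P‖ ^ 2 * ‖D‖ ^ 2) := by ring
        _ ≤ _ := by gcongr
    have h7 : (p : ℝ) ^ 2 * (x * x) ≤ (p : ℝ) ^ 2 * ((20 * K ^ 6 * r) * x) := by
      calc (p : ℝ) ^ 2 * (x * x) = (p * x) ^ 2 := by ring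
        _ ≤ _ := h6
        _ = 20 * K ^ 5 * p ^ 2 * (n * s) := by ring
        _ ≤ 20 * K ^ 5 * p ^ 2 * (K * r * x) := by gcongr
        _ = _ := by ring
    have h8 := le_of_mul_le_mul_left h7 (by positivity)
    rcases hx0.eq_or_lt with h9 | h9
    · rw [← h9]; positivity
    · exact le_of_mul_le_mul_right h8 h9
  have hns : n * s ≤ K * r * (20 * K ^ 6 * r) := hs_le.trans (by gcongr)
  have hs1 : s < 1 := by
    by_contra hcon
    nlinarith [not_lt.1 hcon]
  -- Since r - tr(QP) = s < 1 and tr(QP) is at most the rank d, no rank is lost. This matters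
  -- because `projMat` is the projection only for full column rank.
  have hQPtr : (Q * P).trace ≤ d := by
    have h10 : (Q * P).trace = ‖P * Wh‖ ^ 2 := by
      rw [norm_sq_proj_mul hPs hPP, ← hQ, Matrix.trace_mul_comm]
    have h11 := norm_proj_mul_le hPs hPP Wh
    rw [h10]
    calc ‖P * Wh‖ ^ 2 ≤ ‖Wh‖ ^ 2 := by gcongr
      _ = (d : ℝ) := by rw [norm_sq_orthonormal hWh, Fintype.card_fin]
  have hdeq : d = r := by
    refine le_antisymm hd ?_
    have : (r : ℝ) < d + 1 := by linarith
    exact Nat.lt_succ_iff.1 (by exact_mod_cast this)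
  subst hdeq
  have hproj : projMat Fh = Q := projMat_eq hWh hWCh
  rw [hproj]
  refine ⟨hQs, hQQ, hxle, ?_⟩
  intro ι _ A
  have h12 : ‖Q * (1 - P)‖ ^ 2 = s := by
    rw [norm_sq_proj_mul hQs hQQ, hPs', hPP', Matrix.mul_sub, Matrix.mul_one, Matrix.trace_sub,
      htrQ, hs_eq]
  have h13 : ‖P * A‖ ^ 2 ≤ ‖C‖ ^ 2 * ‖Fᵀ * A‖ ^ 2 := by
    have : P * A = W * (Cᵀ * (Fᵀ * A)) := by
      rw [hP, ← Matrix.mul_assoc Cᵀ, ← Matrix.transpose_mul, ← hWC, Matrix.mul_assoc]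
    rw [this, norm_orthonormal_mul hW, ← Matrix.frobenius_norm_transpose C]
    exact norm_mul_sq_le _ _
  have h14 : Q * A = Q * (1 - P) * A + Q * (P * A) := by
    rw [← Matrix.mul_assoc Q P, ← Matrix.add_mul, ← Matrix.mul_add]
    simp
  -- The part of A orthogonal to the factors passes through Q(1-P), of squared norm s = O(1/n); the
  -- rest is seen only through Fᵀ A.
  have h15 : ‖Q * A‖ ^ 2 ≤ 2 * (s * ‖A‖ ^ 2 + ‖C‖ ^ 2 * ‖Fᵀ * A‖ ^ 2) := by
    rw [h14]
    refine (norm_add_sq_le_two _ _).trans ?_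
    have h16 := norm_mul_sq_le (Q * (1 - P)) A
    rw [h12] at h16
    have h17 : ‖Q * (P * A)‖ ^ 2 ≤ ‖P * A‖ ^ 2 := by
      gcongr
      exact norm_proj_mul_le hQs hQQ _
    linarith
  calc n * ‖Q * A‖ ^ 2 ≤ n * (2 * (s * ‖A‖ ^ 2 + ‖C‖ ^ 2 * ‖Fᵀ * A‖ ^ 2)) := by gcongr
    _ = 2 * ((n * s) * ‖A‖ ^ 2 + (n * ‖C‖ ^ 2) * ‖Fᵀ * A‖ ^ 2) := by ring
    _ ≤ 2 * (K * d * (20 * K ^ 6 * d) * ‖A‖ ^ 2 + (K * d) * ‖Fᵀ * A‖ ^ 2) := by gcongr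
    _ = _ := by ring

/-- With fewer columns than factors, the residual sum of squares exceeds that of the idiosyncratic
part by a multiple of `n p`. -/
lemma FactorBounds.residualSS_ge (h : FactorBounds K F Lam E) (hn : 0 < n) {k : ℕ} (hk : k < r)
    (hlarge : (12 * r ^ 2 * K ^ 4) ^ 2 ≤ (n : ℝ)) (Fh : Matrix (Fin n) (Fin k) ℝ) :
    frobSq E + n * p / (2 * K ^ 2 * r) ≤ residualSS (F * Lamᵀ + E) Fh := by
  have hK := h.one_le
  have hn' : (0 : ℝ) < n := by positivity
  have hr : (1 : ℝ) ≤ r := by exact_mod_cast Nat.one_le_of_lt hk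
  obtain ⟨W, C, hW, hWC, hWF, hC⟩ := h.exists_basis hn
  obtain ⟨d, hd, Wh, Ch, hWh, hWCh, hWhF⟩ := exists_orthonormal_columns Fh
  set X := F * Lamᵀ + E with hX
  set D := X * Xᵀ - (F * Lamᵀ) * (F * Lamᵀ)ᵀ with hD
  have hDle : ‖D‖ ^ 2 ≤ 10 * K ^ 3 * (p ^ 2 * n) := h.norm_gram_sub_sq_le
  set Q := Wh * Whᵀ with hQ
  have hQs : Qᵀ = Q := transpose_self_mul_transpose Wh
  have hQQ : Q * Q = Q := proj_mul_self hWh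
  obtain ⟨hQs', hQQ'⟩ := compl_proj hQs hQQ
  have hXX : X * Xᵀ = (F * Lamᵀ) * (F * Lamᵀ)ᵀ + D := by rw [hD]; abel
  have hkr : (d : ℝ) + 1 ≤ r := by exact_mod_cast (by omega : d + 1 ≤ r)
  have hres : ‖(1 - Q) * X‖ ^ 2 ≤ residualSS X Fh := by
    refine le_ciInf fun L => ?_
    rw [← norm_sq_eq_frobSq]
    gcongr 1
    have h2 : (1 - Q) * X = (1 - Q) * (X - Fh * Lᵀ) := by
      have : (1 - Q) * Fh = 0 := by rw [Matrix.sub_mul, hWhF, Matrix.one_mul, sub_self]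
      rw [Matrix.mul_sub, ← Matrix.mul_assoc, this, Matrix.zero_mul, sub_zero]
    rw [h2]
    exact norm_compl_proj_mul_le hQs hQQ _
  refine le_trans ?_ hres
  -- A projection of rank d ≤ r - 1 captures at most d of the squared norm r of W, so at least one
  -- unit of factor space is missed.
  have hs1 : 1 ≤ ‖(1 - Q) * W‖ ^ 2 := by
    have h1 := norm_sq_proj_add hQs hQQ W
    have h2 : ‖Q * W‖ ^ 2 ≤ d := by
      have h3 : Q * W = (Wh * (Whᵀ * W)) := by rw [hQ, Matrix.mul_assoc]
      have h4 : ‖Q * W‖ ^ 2 = ‖W * Wᵀ * Wh‖ ^ 2 := by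
        rw [h3, norm_orthonormal_mul hWh, Matrix.mul_assoc, norm_orthonormal_mul hW,
          ← Matrix.frobenius_norm_transpose, Matrix.transpose_mul, Matrix.transpose_transpose]
      rw [h4]
      calc ‖W * Wᵀ * Wh‖ ^ 2 ≤ ‖Wh‖ ^ 2 := by
            gcongr
            exact norm_proj_mul_le (transpose_self_mul_transpose W) (proj_mul_self hW) Wh
        _ = (d : ℝ) := by rw [norm_sq_orthonormal hWh, Fintype.card_fin]
    rw [norm_sq_orthonormal hW, Fintype.card_fin] at h1
    linarith
  have hF : n ≤ K * r * ‖(1 - Q) * F‖ ^ 2 := by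
    have h1 : ‖(1 - Q) * W‖ ^ 2 ≤ ‖(1 - Q) * F‖ ^ 2 * ‖C‖ ^ 2 := by
      have h2 := norm_mul_sq_le ((1 - Q) * F) C
      rwa [Matrix.mul_assoc, ← hWC] at h2
    calc (n : ℝ) = n * 1 := by ring
      _ ≤ n * (‖(1 - Q) * F‖ ^ 2 * ‖C‖ ^ 2) := by gcongr; exact hs1.trans h1
      _ = ‖(1 - Q) * F‖ ^ 2 * (n * ‖C‖ ^ 2) := by ring
      _ ≤ ‖(1 - Q) * F‖ ^ 2 * (K * r) := by gcongr
      _ = _ := by ring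
  have hA : n * p / (K ^ 2 * r) ≤ ‖(1 - Q) * (F * Lamᵀ)‖ ^ 2 := by
    rw [div_le_iff₀ (by positivity)]
    have h1 := h.loading_ge' ((1 - Q) * F)
    rw [Matrix.mul_assoc] at h1
    calc (n * p : ℝ) ≤ (K * r * ‖(1 - Q) * F‖ ^ 2) * p := by gcongr
      _ = K * r * (p * ‖(1 - Q) * F‖ ^ 2) := by ring
      _ ≤ K * r * (K * ‖(1 - Q) * (F * Lamᵀ)‖ ^ 2) := by gcongr
      _ = _ := by ring
  have hb : (p : ℝ) ^ 2 * n = (p * √(n : ℝ)) ^ 2 := by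
    rw [mul_pow, Real.sq_sqrt hn'.le]
  have hDle' : ‖D‖ ≤ 4 * K ^ 2 * (p * √(n : ℝ)) := by
    apply le_of_sq_le_sq _ (by positivity)
    refine hDle.trans ?_
    rw [hb]
    have : K ^ 3 ≤ K ^ 4 := pow_le_pow_right₀ hK (by norm_num)
    nlinarith [mul_le_mul_of_nonneg_right this (sq_nonneg (p * √(n : ℝ))),
      mul_nonneg (by positivity : 0 ≤ K ^ 4) (sq_nonneg (p * √(n : ℝ)))]
  have hQD : (Q * D).trace ≤ r * (4 * K ^ 2 * (p * √(n : ℝ))) := by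
    refine (le_abs_self _).trans ((abs_trace_mul_le _ _).trans ?_)
    have h1 : ‖Q‖ ≤ r := by
      apply le_of_sq_le_sq _ (by positivity)
      rw [hQ, norm_orthonormal_mul hWh, Matrix.frobenius_norm_transpose, norm_sq_orthonormal hWh,
        Fintype.card_fin]
      nlinarith
    gcongr
  have hFE : ‖F‖ * ‖E * Lam‖ ≤ K ^ 2 * (p * √(n : ℝ)) := by
    apply le_of_sq_le_sq _ (by positivity)
    refine h.norm_factor_mul_idio_sq_le.trans ?_
    rw [hb, mul_pow (K ^ 2)]
    gcongr
    rw [← pow_mul]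
    exact pow_le_pow_right₀ hK (by norm_num)
  -- The diagonal term is kept exactly: ‖E‖² can be of the same order np as the signal. Only the
  -- cross term is estimated, at order p√n.
  have htrD : frobSq E - 2 * (K ^ 2 * (p * √(n : ℝ))) ≤ D.trace := by
    have h1 : D.trace = frobSq E + 2 * (F * (E * Lam)ᵀ).trace := by
      rw [← norm_sq_eq_frobSq, norm_sq_eq_trace', hD, hX, Matrix.transpose_add, Matrix.add_mul,
        Matrix.mul_add, Matrix.mul_add, Matrix.trace_sub, Matrix.trace_add, Matrix.trace_add,
        Matrix.trace_add]
      have h2 : (E * (F * Lamᵀ)ᵀ).trace = (F * Lamᵀ * Eᵀ).trace := by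
        rw [← Matrix.trace_transpose, Matrix.transpose_mul, Matrix.transpose_transpose]
      have h3 : F * (E * Lam)ᵀ = F * Lamᵀ * Eᵀ := by
        rw [Matrix.transpose_mul, Matrix.mul_assoc]
      rw [h2, h3]
      ring
    have h4 := (neg_abs_le _).trans' (neg_le_neg (abs_trace_mul_le F (E * Lam)ᵀ))
    rw [Matrix.frobenius_norm_transpose] at h4
    linarith
  have hsplit : ‖(1 - Q) * X‖ ^ 2
      = ‖(1 - Q) * (F * Lamᵀ)‖ ^ 2 + D.trace - (Q * D).trace := by
    rw [norm_sq_proj_mul hQs' hQQ', norm_sq_proj_mul hQs' hQQ', hXX, Matrix.mul_add,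
      Matrix.trace_add, Matrix.sub_mul 1 Q D, Matrix.trace_sub, Matrix.one_mul]
    ring
  have hsn : 12 * r ^ 2 * K ^ 4 ≤ √(n : ℝ) := Real.le_sqrt_of_sq_le hlarge
  -- All error terms are of order p√n and for large n take at most half of the missed signal
  -- np/(K²r).
  have hfin : 6 * r * K ^ 2 * (p * √(n : ℝ)) ≤ n * p / (2 * K ^ 2 * r) := by
    rw [le_div_iff₀ (by positivity)]
    calc 6 * r * K ^ 2 * (p * √(n : ℝ)) * (2 * K ^ 2 * r)
        = (12 * r ^ 2 * K ^ 4) * √(n : ℝ) * p := by ring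
      _ ≤ √(n : ℝ) * √(n : ℝ) * p := by gcongr
      _ = n * p := by rw [Real.mul_self_sqrt hn'.le]
  have hhalf : n * p / (K ^ 2 * r) = n * p / (2 * K ^ 2 * r) + n * p / (2 * K ^ 2 * r) := by
    field_simp
    ring
  have h6 : 2 * (K ^ 2 * (p * √(n : ℝ))) + r * (4 * K ^ 2 * (p * √(n : ℝ)))
      ≤ 6 * r * K ^ 2 * (p * √(n : ℝ)) := by
    have : 0 ≤ K ^ 2 * (p * √(n : ℝ)) := by positivity
    nlinarith
  rw [hsplit]
  linarith

end Deterministic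

/-! ### Overfitting and the projected regression -/

section Deterministic

attribute [local instance] Matrix.frobeniusNormedAddCommGroup Matrix.frobeniusNormedSpace

lemma norm_mul_le_specNorm {n p q : ℕ} (E : Matrix (Fin n) (Fin p) ℝ)
    (V : Matrix (Fin p) (Fin q) ℝ) : ‖E * V‖ ≤ specNorm E * ‖V‖ := by
  have h0 : 0 ≤ specNorm E := norm_nonneg _
  apply le_of_sq_le_sq _ (by positivity)
  rw [mul_pow, norm_sq_eq_frobSq, norm_sq_eq_frobSq, frobSq, frobSq, Finset.sum_comm,
    Finset.sum_comm (f := fun i j => V i j ^ 2), Finset.mul_sum]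
  refine Finset.sum_le_sum fun j _ => ?_
  have h := (LinearMap.toContinuousLinearMap (Matrix.toEuclideanLin E)).le_opNorm
    (WithLp.toLp 2 fun i => V i j)
  have h2 := pow_le_pow_left₀ (norm_nonneg _) h 2
  rw [mul_pow, EuclideanSpace.norm_sq_eq, EuclideanSpace.norm_sq_eq] at h2
  simpa [Matrix.mul_apply, Matrix.mulVec, dotProduct, specNorm, Matrix.toLpLin_apply] using h2

/-- Duality: ‖Eᵀ V‖² is the trace of Vᵀ E (Eᵀ V), to which Cauchy–Schwarz and the bound for E apply,
and one factor ‖Eᵀ V‖ cancels. -/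
lemma norm_transpose_mul_le_specNorm {n p q : ℕ} (E : Matrix (Fin n) (Fin p) ℝ)
    (V : Matrix (Fin n) (Fin q) ℝ) : ‖Eᵀ * V‖ ≤ specNorm E * ‖V‖ := by
  have h0 : 0 ≤ specNorm E := norm_nonneg _
  have h1 : ‖Eᵀ * V‖ ^ 2 ≤ ‖V‖ * (specNorm E * ‖Eᵀ * V‖) := by
    rw [norm_sq_eq_trace]
    refine (le_abs_self _).trans ?_
    rw [Matrix.transpose_mul, Matrix.transpose_transpose, Matrix.mul_assoc]
    refine (abs_trace_mul_le _ _).trans ?_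
    rw [Matrix.frobenius_norm_transpose]
    gcongr
    exact norm_mul_le_specNorm E _
  rcases (norm_nonneg (Eᵀ * V)).eq_or_lt with h2 | h2
  · rw [← h2]; positivity
  · refine le_of_mul_le_mul_right ?_ h2
    nlinarith

/-- A low-rank approximation removes at most a multiple of the squared spectral norm. -/
lemma frobSq_sub_le_residualSS {n p r k : ℕ} (F : Matrix (Fin n) (Fin r) ℝ)
    (Lam : Matrix (Fin p) (Fin r) ℝ) (E : Matrix (Fin n) (Fin p) ℝ)
    (Fh : Matrix (Fin n) (Fin k) ℝ) :
    frobSq E - (r + k) * specNorm E ^ 2 ≤ residualSS (F * Lamᵀ + E) Fh := by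
  obtain ⟨d, hd, W, -, hW, -, hWF⟩ := exists_orthonormal_columns Fh
  obtain ⟨e, he, V, -, hV, -, hVL⟩ := exists_orthonormal_columns Lam
  set Q := W * Wᵀ with hQ
  set R := V * Vᵀ with hR
  have hQs : Qᵀ = Q := transpose_self_mul_transpose W
  have hQQ : Q * Q = Q := proj_mul_self hW
  have hRs : Rᵀ = R := transpose_self_mul_transpose V
  have hRR : R * R = R := proj_mul_self hV
  have hdk : (d : ℝ) ≤ k := by exact_mod_cast hd
  have her : (e : ℝ) ≤ r := by exact_mod_cast he
  refine le_ciInf fun L => ?_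
  rw [← norm_sq_eq_frobSq, ← norm_sq_eq_frobSq]
  set Y := F * Lamᵀ + E - Fh * Lᵀ with hY
  have hT : ∀ B : Matrix (Fin n) (Fin p) ℝ, ‖B * (1 - R)‖ = ‖(1 - R) * Bᵀ‖ := fun B => by
    rw [← Matrix.frobenius_norm_transpose, Matrix.transpose_mul, (compl_proj hRs hRR).1]
  have hright : ∀ B : Matrix (Fin n) (Fin p) ℝ, ‖B * (1 - R)‖ ≤ ‖B‖ := fun B => by
    rw [hT, ← Matrix.frobenius_norm_transpose B]
    exact norm_compl_proj_mul_le hRs hRR _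
  -- Compression from the left removes the fitted factors and from the right the true loadings, so
  -- only E survives; each compression costs its rank times the squared spectral norm.
  have h1 : (1 - Q) * (Y * (1 - R)) = (1 - Q) * (E * (1 - R)) := by
    have hLR : Lamᵀ * (1 - R) = 0 := by
      have := congrArg Matrix.transpose hVL
      rw [Matrix.transpose_mul, hRs] at this
      rw [Matrix.mul_sub, this, Matrix.mul_one, sub_self]
    have hQF : (1 - Q) * Fh = 0 := by rw [Matrix.sub_mul, hWF, Matrix.one_mul, sub_self]
    rw [hY, Matrix.sub_mul (F * Lamᵀ + E), Matrix.add_mul, Matrix.mul_assoc F, hLR, Matrix.mul_zero, zero_add,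
      Matrix.mul_sub (1 - Q), Matrix.mul_assoc Fh, ← Matrix.mul_assoc _ Fh, hQF, Matrix.zero_mul, sub_zero]
  have h2 : ‖(1 - Q) * (E * (1 - R))‖ ^ 2 ≤ ‖Y‖ ^ 2 := by
    rw [← h1]
    gcongr 1
    exact (norm_compl_proj_mul_le hQs hQQ _).trans (hright _)
  have h3 := norm_sq_proj_add hQs hQQ (E * (1 - R))
  have h4 : ‖Q * (E * (1 - R))‖ ^ 2 ≤ k * specNorm E ^ 2 := by
    have h5 : ‖Q * (E * (1 - R))‖ ≤ specNorm E * ‖W‖ := by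
      rw [← Matrix.mul_assoc]
      refine (hright _).trans ?_
      rw [hQ, Matrix.mul_assoc, norm_orthonormal_mul hW, ← Matrix.frobenius_norm_transpose,
        Matrix.transpose_mul, Matrix.transpose_transpose]
      exact norm_transpose_mul_le_specNorm E W
    calc _ ≤ (specNorm E * ‖W‖) ^ 2 := by gcongr
      _ = specNorm E ^ 2 * d := by rw [mul_pow, norm_sq_orthonormal hW, Fintype.card_fin]
      _ ≤ specNorm E ^ 2 * k := by gcongr
      _ = _ := by ring
  have h6 := norm_sq_proj_add hRs hRR Eᵀ
  rw [← hT, Matrix.frobenius_norm_transpose] at h6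
  have h7 : ‖R * Eᵀ‖ ^ 2 ≤ r * specNorm E ^ 2 := by
    have h8 : ‖R * Eᵀ‖ ≤ specNorm E * ‖V‖ := by
      rw [hR, Matrix.mul_assoc, norm_orthonormal_mul hV, ← Matrix.frobenius_norm_transpose,
        Matrix.transpose_mul, Matrix.transpose_transpose, Matrix.transpose_transpose]
      exact norm_mul_le_specNorm E V
    calc _ ≤ (specNorm E * ‖V‖) ^ 2 := by gcongr
      _ = specNorm E ^ 2 * e := by rw [mul_pow, norm_sq_orthonormal hV, Fintype.card_fin]
      _ ≤ specNorm E ^ 2 * r := by gcongr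
      _ = _ := by ring
  linarith

/-- Bounds on the quantities entering the regression on the selected variables: `Q` is the
projection on the estimated factors, `w = F a + u` the true residual. -/
structure SelectionBounds (K : ℝ) {n r : ℕ} {ι : Type} [Fintype ι] (Q : Matrix (Fin n) (Fin n) ℝ)
    (F : Matrix (Fin n) (Fin r) ℝ) (L : Matrix ι (Fin r) ℝ) (E : Matrix (Fin n) ι ℝ)
    (a : Matrix (Fin r) (Fin 1) ℝ) (u : Matrix (Fin n) (Fin 1) ℝ) : Prop where
  one_le : 1 ≤ K
  symm : Qᵀ = Q
  idem : Q * Q = Q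
  compl_factor : ‖(1 - Q) * F‖ ^ 2 ≤ K
  proj_idio : ‖Q * E‖ ^ 2 ≤ K * Fintype.card ι
  loading : ‖L‖ ^ 2 ≤ K * Fintype.card ι
  idio : ‖E‖ ^ 2 ≤ K * (n * Fintype.card ι)
  idio_ge : ∀ V : Matrix ι (Fin 1) ℝ, n * ‖V‖ ^ 2 ≤ K * ‖E * V‖ ^ 2
  coeff : ‖a‖ ^ 2 ≤ K
  noise : ‖u‖ ^ 2 ≤ K * n
  idio_noise : ‖Eᵀ * u‖ ^ 2 ≤ K * (n * Fintype.card ι)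

/-- Error of the least squares coefficients after projecting out the estimated factors. -/
lemma SelectionBounds.norm_coeff_error_sq_le {K : ℝ} {n r : ℕ} {ι : Type} [Fintype ι]
    [DecidableEq ι] {Q : Matrix (Fin n) (Fin n) ℝ}
    {F : Matrix (Fin n) (Fin r) ℝ} {L : Matrix ι (Fin r) ℝ} {E : Matrix (Fin n) ι ℝ}
    {a : Matrix (Fin r) (Fin 1) ℝ} {u : Matrix (Fin n) (Fin 1) ℝ}
    (h : SelectionBounds K Q F L E a u) (hn : 0 < n)
    (hlarge : 16 * K ^ 3 * Fintype.card ι ≤ (n : ℝ)) :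
    let Xt := (1 - Q) * (F * Lᵀ + E)
    (Xtᵀ * Xt).det ≠ 0 ∧
      n * ‖(Xtᵀ * Xt)⁻¹ * (Xtᵀ * (F * a + u))‖ ^ 2 ≤ 720 * K ^ 6 * Fintype.card ι := by
  intro Xt
  have hK := h.one_le
  have hn' : (1 : ℝ) ≤ n := by exact_mod_cast hn
  set m : ℝ := (Fintype.card ι : ℝ) with hm
  have hm0 : 0 ≤ m := by positivity
  obtain ⟨hs', hi'⟩ := compl_proj h.symm h.idem
  set Δ := (1 - Q) * F with hΔ
  set R := Δ * Lᵀ - Q * E with hR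
  have hXt : Xt = E + R := by
    simp only [Xt, hR, hΔ, Matrix.mul_add, Matrix.sub_mul, Matrix.one_mul, Matrix.mul_assoc]
    abel
  have hRle : ‖R‖ ^ 2 ≤ 4 * K ^ 2 * m := by
    have h1 := norm_add_sq_le_two (Δ * Lᵀ) (-(Q * E))
    rw [norm_neg, ← sub_eq_add_neg, ← hR] at h1
    have h2 : ‖Δ * Lᵀ‖ ^ 2 ≤ K * (K * m) := by
      refine (norm_mul_sq_le _ _).trans ?_
      rw [Matrix.frobenius_norm_transpose]
      gcongr
      · exact h.compl_factor
      · exact h.loading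
    have h3 := h.proj_idio
    have h4 : K * m ≤ K * (K * m) := le_mul_of_one_le_left (by positivity) hK
    nlinarith
  -- The perturbation R contributes 8K³m‖V‖², which the size condition makes at most half of n‖V‖²,
  -- and it is absorbed on the left.
  have hge : ∀ V : Matrix ι (Fin 1) ℝ, n * ‖V‖ ^ 2 ≤ 4 * K * ‖Xt * V‖ ^ 2 := by
    intro V
    have h1 : E * V = Xt * V + -(R * V) := by rw [hXt, Matrix.add_mul]; abel
    have h2 := norm_add_sq_le_two (Xt * V) (-(R * V))
    rw [← h1, norm_neg] at h2
    have h3 := (norm_mul_sq_le R V).trans (mul_le_mul_of_nonneg_right hRle (sq_nonneg ‖V‖))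
    have h4 : n * ‖V‖ ^ 2 ≤ K * (2 * (‖Xt * V‖ ^ 2 + 4 * K ^ 2 * m * ‖V‖ ^ 2)) := by
      refine (h.idio_ge V).trans ?_
      gcongr
      linarith
    have h5 := mul_le_mul_of_nonneg_right hlarge (sq_nonneg ‖V‖)
    nlinarith
  have hdet : (Xtᵀ * Xt).det ≠ 0 := by
    intro h0
    obtain ⟨v, hv0, hv⟩ := Matrix.exists_mulVec_eq_zero_iff.2 h0
    set V := Matrix.replicateCol (Fin 1) v with hV
    have h1 : Xtᵀ * Xt * V = 0 := by
      rw [hV, ← Matrix.replicateCol_mulVec, hv]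
      ext
      simp
    have h2 : ‖Xt * V‖ ^ 2 = 0 := by
      rw [norm_sq_eq_trace, Matrix.transpose_mul, Matrix.mul_assoc, ← Matrix.mul_assoc Xtᵀ, h1]
      simp
    have h3 := hge V
    rw [h2] at h3
    have h4 : V = 0 := by
      rw [← norm_eq_zero]
      nlinarith [norm_nonneg V, sq_nonneg ‖V‖]
    apply hv0
    ext a
    exact congrFun (congrFun h4 a) 0
  refine ⟨hdet, ?_⟩
  set w := F * a + u with hw
  set δ := (Xtᵀ * Xt)⁻¹ * (Xtᵀ * w) with hδ
  have hδeq : Xtᵀ * Xt * δ = Xtᵀ * w := by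
    rw [hδ, ← Matrix.mul_assoc, Matrix.mul_nonsing_inv _ (Ne.isUnit hdet), Matrix.one_mul]
  have h1 : n * ‖δ‖ ≤ 4 * K * ‖Xtᵀ * w‖ := by
    have h2 : ‖Xt * δ‖ ^ 2 ≤ ‖δ‖ * ‖Xtᵀ * w‖ := by
      rw [norm_sq_eq_trace, Matrix.transpose_mul, Matrix.mul_assoc, ← Matrix.mul_assoc Xtᵀ, hδeq,
        ← Matrix.frobenius_norm_transpose δ]
      exact (le_abs_self _).trans (abs_trace_mul_le _ _)
    rcases (norm_nonneg δ).eq_or_lt with h3 | h3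
    · rw [← h3]; simp; positivity
    · refine le_of_mul_le_mul_right ?_ h3
      have h4 := hge δ
      nlinarith
  have h2 : ‖Xtᵀ * w‖ ^ 2 ≤ 45 * K ^ 4 * (n * m) := by
    -- This replaces F by Δ = (1-Q)F in the right-hand side, turning a factor of squared norm O(n)
    -- into one of squared norm O(1).
    have hXtC : Xtᵀ = Xtᵀ * (1 - Q) := by
      have : Xt = (1 - Q) * Xt := by
        simp only [Xt]
        rw [← Matrix.mul_assoc, hi']
      conv_lhs => rw [this, Matrix.transpose_mul, hs']
    have h3 : Xtᵀ * w = Xtᵀ * (Δ * a) + (Eᵀ * u + Rᵀ * u) := by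
      rw [hw, Matrix.mul_add, ← Matrix.add_mul, ← Matrix.transpose_add, ← hXt, hΔ]
      nth_rw 1 [hXtC]
      simp only [Matrix.mul_assoc]
    have h4 : ‖Xtᵀ‖ ^ 2 ≤ 10 * K ^ 2 * (n * m) := by
      rw [Matrix.frobenius_norm_transpose, hXt]
      have h5 := norm_add_sq_le_two E R
      have h6 := h.idio
      have h7 : 4 * K ^ 2 * m ≤ 4 * K ^ 2 * (n * m) := by
        gcongr; exact le_mul_of_one_le_left hm0 hn'
      have h8 : K * (n * m) ≤ K ^ 2 * (n * m) := by
        gcongr; exact le_self_pow₀ hK (by norm_num)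
      linarith
    have h5 : ‖Xtᵀ * (Δ * a)‖ ^ 2 ≤ 10 * K ^ 2 * (n * m) * (K * K) := by
      refine (norm_mul_sq_le _ _).trans ?_
      gcongr
      refine (norm_mul_sq_le _ _).trans ?_
      gcongr
      · exact h.compl_factor
      · exact h.coeff
    have h6 : ‖Rᵀ * u‖ ^ 2 ≤ 4 * K ^ 2 * m * (K * n) := by
      refine (norm_mul_sq_le _ _).trans ?_
      rw [Matrix.frobenius_norm_transpose]
      gcongr
      exact h.noise
    have h7 := norm_add_sq_le_two (Xtᵀ * (Δ * a)) (Eᵀ * u + Rᵀ * u)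
    have h8 := norm_add_sq_le_two (Eᵀ * u) (Rᵀ * u)
    rw [← h3] at h7
    have h9 := h.idio_noise
    have h10 : K * (n * m) ≤ K ^ 4 * (n * m) := by
      gcongr; exact le_self_pow₀ hK (by norm_num)
    have h11 : K ^ 3 * (n * m) ≤ K ^ 4 * (n * m) := by
      gcongr 1; exact pow_le_pow_right₀ hK (by norm_num)
    nlinarith
  have h3 : n * (n * ‖δ‖ ^ 2) ≤ n * (720 * K ^ 6 * m) := by
    calc n * (n * ‖δ‖ ^ 2) = (n * ‖δ‖) ^ 2 := by ring
      _ ≤ (4 * K * ‖Xtᵀ * w‖) ^ 2 := by gcongr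
      _ = 16 * K ^ 2 * ‖Xtᵀ * w‖ ^ 2 := by ring
      _ ≤ 16 * K ^ 2 * (45 * K ^ 4 * (n * m)) := by gcongr
      _ = _ := by ring
  exact le_of_mul_le_mul_left h3 (by positivity)

end Deterministic

/-! ### From sample bounds to the residual error -/

section Deterministic

attribute [local instance] Matrix.frobeniusNormedAddCommGroup Matrix.frobeniusNormedSpace

lemma norm_replicateCol_sq {ι : Type*} [Fintype ι] (v : ι → ℝ) :
    ‖Matrix.replicateCol (Fin 1) v‖ ^ 2 = ∑ i, v i ^ 2 := by
  rw [norm_sq_eq_frobSq]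
  simp [frobSq]

variable {Ω : Type*} [MeasurableSpace Ω] {r : ℕ}

namespace Model

/-- The loadings of the selected variables. -/
def LamJ (D : Model Ω r) (n : ℕ) : Matrix (D.J n) (Fin r) ℝ :=
  (D.Lam n).submatrix Subtype.val id

/-- The coefficients with the selected ones replaced by zero. -/
def βc (D : Model Ω r) (n : ℕ) : Fin (D.p n) → ℝ := fun i => if i ∈ D.J n then 0 else D.β n i

/-- The part of the residual `w_J` that is not explained by the factors. -/
def noise (D : Model Ω r) (n : ℕ) (ω : Ω) : Fin n → ℝ := D.E n ω *ᵥ D.βc n + D.err n ω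

variable (D : Model Ω r) (n : ℕ) (ω : Ω)

lemma card_J : (Fintype.card (D.J n) : ℝ) = D.m n := by
  simp [m]

lemma XJ_eq : D.XJ n ω = D.F n ω * (D.LamJ n)ᵀ + D.EJ n ω := by
  ext t j
  simp [XJ, X, EJ, LamJ, Matrix.mul_apply]

lemma XJ_mulVec_βJ : D.XJ n ω *ᵥ D.βJ n = D.X n ω *ᵥ (D.β n - D.βc n) := by
  ext t
  simp only [Matrix.mulVec, dotProduct, XJ, βJ, Matrix.submatrix_apply, id]
  rw [← Finset.sum_subset (Finset.subset_univ (D.J n)),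
    ← Finset.sum_coe_sort (D.J n) fun i => D.X n ω t i * (D.β n - D.βc n) i]
  · refine Finset.sum_congr rfl fun j _ => ?_
    simp [βc, j.2]
  · intro i _ hi
    simp [βc, hi]

/-- The unselected variables load on the same factors, so w_J contains a factor term correlated with
X_J. It is harmless only because the estimated factors are projected out. -/
lemma wJ_eq : D.wJ n ω = D.F n ω *ᵥ ((D.Lam n)ᵀ *ᵥ D.βc n) + D.noise n ω := by
  rw [wJ, Y, XJ_mulVec_βJ, Matrix.mulVec_sub, noise, X, Matrix.mulVec_mulVec, Matrix.add_mulVec,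
    Matrix.add_mulVec]
  abel

/-- The bounds under which the estimated residual is close to the true one. -/
structure SampleBounds (K : ℝ) : Prop where
  factor : FactorBounds K (D.F n ω) (D.Lam n) (D.E n ω)
  loading : ‖D.LamJ n‖ ^ 2 ≤ K * D.m n
  idio : ‖D.EJ n ω‖ ^ 2 ≤ K * (n * D.m n)
  factor_idio : ‖(D.F n ω)ᵀ * D.EJ n ω‖ ^ 2 ≤ K * (n * D.m n)
  idio_ge : ∀ V : Matrix (D.J n) (Fin 1) ℝ, n * ‖V‖ ^ 2 ≤ K * ‖D.EJ n ω * V‖ ^ 2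
  coeff : ∑ a, ((D.Lam n)ᵀ *ᵥ D.βc n) a ^ 2 ≤ K
  noise : ∑ t, D.noise n ω t ^ 2 ≤ K * n
  idio_noise : ∑ j, ((D.EJ n ω)ᵀ *ᵥ D.noise n ω) j ^ 2 ≤ K * (n * D.m n)

variable {D n ω}

/-- The constant is set by the bound on ‖Q E_J‖²: a factor 2Kr times 21K⁷r from `exists_proj`
applied to E_J. It dominates all the others because K and r are at least 1. -/
lemma SampleBounds.selectionBounds {K : ℝ} (h : D.SampleBounds n ω K) (hr : 1 ≤ r) (hn : 0 < n)
    (hp : 0 < D.p n) (hlarge : 20 * K ^ 7 * r ^ 2 < n) {Fh : Matrix (Fin n) (Fin r) ℝ}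
    (hopt : ∀ (U : Matrix (Fin n) (Fin r) ℝ) (L : Matrix (Fin (D.p n)) (Fin r) ℝ),
      residualSS (D.X n ω) Fh ≤ frobSq (D.X n ω - U * Lᵀ)) :
    SelectionBounds (42 * K ^ 8 * r ^ 2) (projMat Fh) (D.F n ω) (D.LamJ n) (D.EJ n ω)
      (Matrix.replicateCol (Fin 1) ((D.Lam n)ᵀ *ᵥ D.βc n))
      (Matrix.replicateCol (Fin 1) (D.noise n ω)) := by
  have hK := h.factor.one_le
  have hr' : (1 : ℝ) ≤ r := by exact_mod_cast hr
  have hn' : (0 : ℝ) < n := by positivity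
  have hK8 : K ≤ K ^ 8 := le_self_pow₀ hK (by norm_num)
  have hr2 : (1 : ℝ) ≤ (r : ℝ) ^ 2 := one_le_pow₀ hr'
  have hKK : K ≤ 42 * K ^ 8 * r ^ 2 := by nlinarith [mul_le_mul hK8 hr2 (by norm_num) (by positivity)]
  obtain ⟨hs, hi, hc, hproj⟩ := h.factor.exists_proj hn hp hlarge hopt
  refine ⟨hK.trans hKK, hs, hi, hc.trans ?_, ?_, ?_, ?_, ?_, ?_, ?_, ?_⟩
  · have h1 : K ^ 6 ≤ K ^ 8 := pow_le_pow_right₀ hK (by norm_num)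
    have h2 : (r : ℝ) ≤ r ^ 2 := le_self_pow₀ hr' (by norm_num)
    have h3 := mul_le_mul h1 h2 (by positivity) (by positivity)
    nlinarith [mul_nonneg (pow_nonneg (zero_le_one.trans hK) 8) (sq_nonneg (r : ℝ))]
  · have h1 := hproj (D.EJ n ω)
    rw [card_J]
    refine le_of_mul_le_mul_left (h1.trans ?_) hn'
    have h2 : 20 * K ^ 6 * r * ‖D.EJ n ω‖ ^ 2 + ‖(D.F n ω)ᵀ * D.EJ n ω‖ ^ 2
        ≤ 21 * K ^ 7 * r * (n * D.m n) := by
      have h3 : 20 * K ^ 6 * r * ‖D.EJ n ω‖ ^ 2 ≤ 20 * K ^ 6 * r * (K * (n * D.m n)) := by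
        gcongr
        exact h.idio
      have h4 : K * (n * D.m n) ≤ K ^ 7 * r * (n * D.m n) := by
        gcongr
        calc K ≤ K ^ 7 := le_self_pow₀ hK (by norm_num)
          _ ≤ K ^ 7 * r := le_mul_of_one_le_right (by positivity) hr'
      have h5 := h.factor_idio
      linarith
    calc 2 * (K * r) * _ ≤ 2 * (K * r) * (21 * K ^ 7 * r * (n * D.m n)) := by gcongr
      _ = _ := by ring
  · rw [card_J]
    exact h.loading.trans (by gcongr)
  · rw [card_J]
    exact h.idio.trans (by gcongr)
  · exact fun V => (h.idio_ge V).trans (by gcongr)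
  · rw [norm_replicateCol_sq]
    exact h.coeff.trans hKK
  · rw [norm_replicateCol_sq]
    exact h.noise.trans (by gcongr)
  · rw [← Matrix.replicateCol_mulVec, norm_replicateCol_sq, card_J]
    exact h.idio_noise.trans (by gcongr)

/-- The estimated residual is close to the true one, coordinatewise. -/
lemma SampleBounds.residual_error_sq_le {K : ℝ} (h : D.SampleBounds n ω K) (hr : 1 ≤ r)
    (hn : 0 < n) (hp : 0 < D.p n) (hlarge : 20 * K ^ 7 * r ^ 2 < n)
    (hm : 16 * (42 * K ^ 8 * r ^ 2) ^ 3 * D.m n ≤ (n : ℝ)) {Fh : Matrix (Fin n) (Fin r) ℝ}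
    (hF : IsFactorEstimate (D.X n ω) Fh) (t : Fin n) :
    n * (D.wtildeJ n ω Fh t - D.wJ n ω t) ^ 2
      ≤ 720 * (42 * K ^ 8 * r ^ 2) ^ 6 * D.m n * ∑ j, D.XJ n ω t j ^ 2 := by
  have hsel := h.selectionBounds hr hn hp hlarge
    (residualSS_le_of_isFactorEstimate hn.ne' hp.ne' hF)
  obtain ⟨hdet, hδ⟩ := hsel.norm_coeff_error_sq_le hn (by rwa [card_J])
  rw [← XJ_eq, card_J] at hδ
  rw [← XJ_eq] at hdet
  have hXt : (1 - projMat Fh) * D.XJ n ω = D.XtildeJ n ω Fh := rfl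
  rw [hXt] at hδ hdet
  set Xt := D.XtildeJ n ω Fh with hXtdef
  rw [← Matrix.replicateCol_mulVec, ← Matrix.replicateCol_add, ← wJ_eq, ← Matrix.replicateCol_mulVec,
    ← Matrix.replicateCol_mulVec, norm_replicateCol_sq] at hδ
  set δ := (Xtᵀ * Xt)⁻¹ *ᵥ (Xtᵀ *ᵥ D.wJ n ω) with hδdef
  -- As 1 - Q is an idempotent, the normal equations may be read with the unprojected regressors, so
  -- the estimation error is the projected regression of w_J.
  have hXtX : Xtᵀ * D.XJ n ω = Xtᵀ * Xt := by
    obtain ⟨hs', hi'⟩ := compl_proj hsel.symm hsel.idem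
    rw [← hXt, Matrix.transpose_mul, hs', Matrix.mul_assoc, Matrix.mul_assoc,
      ← Matrix.mul_assoc (1 - projMat Fh), hi']
  have hβ : D.βtildeJ n ω Fh = D.βJ n + δ := by
    have hY : D.Y n ω = D.XJ n ω *ᵥ D.βJ n + D.wJ n ω := by rw [wJ]; abel
    rw [βtildeJ, ← hXtdef, hY, Matrix.mulVec_add, Matrix.mulVec_mulVec, hXtX, Matrix.mulVec_add,
      Matrix.mulVec_mulVec, Matrix.nonsing_inv_mul _ (Ne.isUnit hdet), Matrix.one_mulVec]
  have hdiff : D.wtildeJ n ω Fh t - D.wJ n ω t = -∑ j, D.XJ n ω t j * δ j := by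
    rw [wtildeJ, wJ, hβ, Matrix.mulVec_add]
    simp only [Pi.sub_apply, Pi.add_apply, Matrix.mulVec, dotProduct]
    ring
  rw [hdiff, neg_sq]
  have hcs := Finset.sum_mul_sq_le_sq_mul_sq Finset.univ (fun j => D.XJ n ω t j) δ
  calc n * (∑ j, D.XJ n ω t j * δ j) ^ 2
      ≤ n * ((∑ j, D.XJ n ω t j ^ 2) * ∑ j, δ j ^ 2) := by gcongr
    _ = (n * ∑ j, δ j ^ 2) * ∑ j, D.XJ n ω t j ^ 2 := by ring
    _ ≤ _ := by gcongr

end Model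

end Deterministic

/-! ### Moment bounds, likely events and the Lévy–Prokhorov metric -/

section Probability

variable {Ω : Type*} [MeasurableSpace Ω] {μ : Measure Ω}

/-! ## Expectations -/

lemma ExpLE.add {Z Z' : Ω → ℝ} {C C' : ℝ} (h : ExpLE μ Z C) (h' : ExpLE μ Z' C') :
    ExpLE μ (fun ω => Z ω + Z' ω) (C + C') :=
  ⟨h.1.add h'.1, by rw [integral_add h.1 h'.1]; exact add_le_add h.2 h'.2⟩

lemma ExpLE.const_mul {Z : Ω → ℝ} {C : ℝ} (h : ExpLE μ Z C) {c : ℝ} (hc : 0 ≤ c) :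
    ExpLE μ (fun ω => c * Z ω) (c * C) :=
  ⟨h.1.const_mul c, by rw [integral_const_mul]; exact mul_le_mul_of_nonneg_left h.2 hc⟩

lemma ExpLE.sum {ι : Type*} {s : Finset ι} {Z : ι → Ω → ℝ} {C : ι → ℝ}
    (h : ∀ i ∈ s, ExpLE μ (Z i) (C i)) : ExpLE μ (fun ω => ∑ i ∈ s, Z i ω) (∑ i ∈ s, C i) := by
  refine ⟨integrable_finsetSum s fun i hi => (h i hi).1, ?_⟩
  rw [integral_finsetSum s fun i hi => (h i hi).1]
  exact Finset.sum_le_sum fun i hi => (h i hi).2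

lemma ExpLE.trans {Z : Ω → ℝ} {C C' : ℝ} (h : ExpLE μ Z C) (hC : C ≤ C') : ExpLE μ Z C' :=
  ⟨h.1, h.2.trans hC⟩

lemma ExpLE.mono {Z Z' : Ω → ℝ} {C : ℝ} (h : ExpLE μ Z C) (hm : Measurable Z')
    (h0 : ∀ ω, 0 ≤ Z' ω) (hle : ∀ ω, Z' ω ≤ Z ω) : ExpLE μ Z' C := by
  have hi : Integrable Z' μ := h.1.mono' hm.aestronglyMeasurable
    (Eventually.of_forall fun ω => by rw [Real.norm_of_nonneg (h0 ω)]; exact hle ω)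
  exact ⟨hi, (integral_mono hi h.1 hle).trans h.2⟩

lemma expLE_const [IsProbabilityMeasure μ] (c : ℝ) : ExpLE μ (fun _ => c) c :=
  ⟨integrable_const c, by simp⟩

lemma sq_le_one_add_abs_pow_eight (x : ℝ) : x ^ 2 ≤ 1 + |x| ^ 8 := by
  have h : |x| ^ 8 = (x ^ 2) ^ 4 := by
    rw [← sq_abs x]; ring
  rw [h]
  nlinarith [sq_nonneg ((x ^ 2) ^ 2 - 1 / 2), sq_nonneg (x ^ 2 - 1 / 2)]

lemma sq_le_one_add_abs_pow_four (x : ℝ) : x ^ 2 ≤ 1 + |x| ^ 4 := by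
  have h : |x| ^ 4 = (x ^ 2) ^ 2 := by
    rw [← sq_abs x]; ring
  rw [h]
  nlinarith [sq_nonneg (x ^ 2 - 1 / 2)]

/-- Cauchy–Schwarz with weights |b i|: only the ℓ¹ norm of the coefficients enters, so bounds for
each summand carry over without a factor growing with p. -/
lemma sq_sum_mul_le {ι : Type*} (s : Finset ι) (b x : ι → ℝ) :
    (∑ i ∈ s, b i * x i) ^ 2 ≤ (∑ i ∈ s, |b i|) * ∑ i ∈ s, |b i| * x i ^ 2 := by
  refine Finset.sum_sq_le_sum_mul_sum_of_sq_le_mul s (fun i _ => abs_nonneg _)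
    (fun i _ => by positivity) fun i _ => le_of_eq ?_
  rw [← mul_assoc, ← sq, sq_abs]
  ring

/-! ## Events of probability close to one -/

/-- For every `η > 0` and every sufficiently large constant `K`, the property `P K n` fails with
probability at most `η` for all large `n`. -/
def EventuallyLikely (μ : Measure Ω) (P : ℝ → ℕ → Ω → Prop) : Prop :=
  ∀ η : ℝ, 0 < η → ∃ K₀ : ℝ, ∀ K ≥ K₀, ∀ᶠ n in atTop, μ {ω | ¬ P K n ω} ≤ ENNReal.ofReal η

namespace EventuallyLikely

variable {P Q : ℝ → ℕ → Ω → Prop}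

/-- Asking for every K beyond a threshold, rather than some K, lets two properties share a constant
without being monotone in it. -/
lemma and (hP : EventuallyLikely μ P) (hQ : EventuallyLikely μ Q) :
    EventuallyLikely μ fun K n ω => P K n ω ∧ Q K n ω := by
  intro η hη
  obtain ⟨K₁, h₁⟩ := hP (η / 2) (by positivity)
  obtain ⟨K₂, h₂⟩ := hQ (η / 2) (by positivity)
  refine ⟨max K₁ K₂, fun K hK => ?_⟩
  filter_upwards [h₁ K (le_of_max_le_left hK), h₂ K (le_of_max_le_right hK)] with n h1 h2
  calc μ {ω | ¬ (P K n ω ∧ Q K n ω)} ≤ μ ({ω | ¬ P K n ω} ∪ {ω | ¬ Q K n ω}) := by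
        apply measure_mono
        intro ω hω
        simp only [Set.mem_ofPred_eq, Set.mem_union] at hω ⊢
        tauto
    _ ≤ _ := measure_union_le _ _
    _ ≤ ENNReal.ofReal (η / 2) + ENNReal.ofReal (η / 2) := add_le_add h1 h2
    _ = ENNReal.ofReal η := by
        rw [← ENNReal.ofReal_add (by positivity) (by positivity), add_halves]

lemma mono (hP : EventuallyLikely μ P) (K₁ : ℝ)
    (h : ∀ K ≥ K₁, ∀ᶠ n in atTop, ∀ ω, P K n ω → Q K n ω) : EventuallyLikely μ Q := by
  intro η hη
  obtain ⟨K₀, h₀⟩ := hP η hη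
  refine ⟨max K₀ K₁, fun K hK => ?_⟩
  filter_upwards [h₀ K (le_of_max_le_left hK), h K (le_of_max_le_right hK)] with n h1 h2
  refine le_trans (measure_mono ?_) h1
  intro ω hω hP
  exact hω (h2 ω hP)

lemma rescale (hP : EventuallyLikely μ P) {c : ℝ} (hc : 0 < c) :
    EventuallyLikely μ fun K => P (c * K) := by
  intro η hη
  obtain ⟨K₀, h₀⟩ := hP η hη
  refine ⟨K₀ / c, fun K hK => h₀ (c * K) ?_⟩
  rw [ge_iff_le, div_le_iff₀ hc] at hK
  linarith

lemma of_tendsto {A : ℕ → Ω → Prop} (h : Tendsto (fun n => μ {ω | ¬ A n ω}) atTop (𝓝 0)) :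
    EventuallyLikely μ fun _ => A := by
  intro η hη
  refine ⟨0, fun _ _ => ?_⟩
  exact h.eventually_le_const (by simpa using hη)

lemma of_ae {A : ℕ → Ω → Prop} (h : ∀ᶠ n in atTop, ∀ᵐ ω ∂μ, A n ω) :
    EventuallyLikely μ fun _ => A := by
  refine of_tendsto (tendsto_const_nhds.congr' ?_)
  filter_upwards [h] with n hn
  exact (ae_iff.1 hn).symm

lemma tendsto {A : ℕ → Ω → Prop} (h : EventuallyLikely μ fun _ => A) :
    Tendsto (fun n => μ {ω | ¬ A n ω}) atTop (𝓝 0) := by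
  rw [ENNReal.tendsto_nhds_zero]
  intro ε hε
  obtain ⟨η, hη0, hηε⟩ := ENNReal.lt_iff_exists_nnreal_btwn.1 hε
  obtain ⟨K, hK⟩ := h η (by exact_mod_cast hη0)
  filter_upwards [hK K le_rfl] with n hn
  refine hn.trans ?_
  rw [ENNReal.ofReal_coe_nnreal]
  exact hηε.le

/-- Removing the constant: it suffices to have the conclusion for every `K` and large `n`. -/
lemma tendsto_of_mono {A : ℕ → Ω → Prop} (hP : EventuallyLikely μ P) (K₁ : ℝ)
    (h : ∀ K ≥ K₁, ∀ᶠ n in atTop, ∀ ω, P K n ω → A n ω) :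
    Tendsto (fun n => μ {ω | ¬ A n ω}) atTop (𝓝 0) :=
  (hP.mono (Q := fun _ => A) K₁ h).tendsto

/-- Markov's inequality. -/
lemma of_expLE [IsProbabilityMeasure μ] {Z : ℕ → Ω → ℝ} {b : ℕ → ℝ} (hb : ∀ n, 0 ≤ b n)
    (hZ : ∀ n ω, 0 ≤ Z n ω) (C : ℝ) (h : ∀ᶠ n in atTop, ExpLE μ (Z n) (C * b n)) :
    EventuallyLikely μ fun K n ω => Z n ω ≤ K * b n := by
  intro η hη
  refine ⟨max (|C| / η) 1, fun K hK => ?_⟩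
  have hK1 : 1 ≤ K := le_of_max_le_right hK
  have hKC : |C| ≤ K * η := by
    have := le_of_max_le_left hK
    rwa [div_le_iff₀ hη] at this
  filter_upwards [h] with n hn
  -- The scale b n can vanish, for instance when no variable is selected; then Z n is almost surely
  -- zero.
  rcases (hb n).eq_or_lt with h0 | h0
  · have h1 : ∫ ω, Z n ω ∂μ = 0 := by
      refine le_antisymm ?_ (integral_nonneg (hZ n))
      simpa [← h0] using hn.2
    have h2 := (integral_eq_zero_iff_of_nonneg (hZ n) hn.1).1 h1
    have h3 : μ {ω | ¬ Z n ω ≤ K * b n} = 0 := by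
      rw [← ae_iff]
      filter_upwards [h2] with ω hω
      simp [hω, ← h0]
    rw [h3]
    exact zero_le
  · have h1 := mul_meas_ge_le_integral_of_nonneg (Eventually.of_forall (hZ n)) hn.1 (K * b n)
    have h2 : μ.real {ω | K * b n ≤ Z n ω} ≤ η := by
      have h3 : K * b n * μ.real {ω | K * b n ≤ Z n ω} ≤ K * b n * η := by
        refine h1.trans (hn.2.trans ?_)
        calc C * b n ≤ |C| * b n := by gcongr; exact le_abs_self C
          _ ≤ K * η * b n := by gcongr
          _ = K * b n * η := by ring
      exact le_of_mul_le_mul_left h3 (by positivity)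
    calc μ {ω | ¬ Z n ω ≤ K * b n} ≤ μ {ω | K * b n ≤ Z n ω} :=
          measure_mono fun ω hω => (not_le.1 hω).le
      _ = ENNReal.ofReal (μ.real {ω | K * b n ≤ Z n ω}) := by simp
      _ ≤ _ := ENNReal.ofReal_le_ofReal h2

lemma of_tendstoInMeasure {Z : ℕ → Ω → ℝ} (h : TendstoInMeasure μ Z atTop fun _ => 0) {δ : ℝ}
    (hδ : 0 < δ) : EventuallyLikely μ fun _ n ω => Z n ω < δ := by
  rw [tendstoInMeasure_iff_norm] at h
  refine of_tendsto (tendsto_of_tendsto_of_tendsto_of_le_of_le tendsto_const_nhds (h δ hδ)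
    (fun _ => zero_le) fun n => measure_mono fun ω hω => ?_)
  simp only [Set.mem_ofPred_eq, not_lt, sub_zero] at hω ⊢
  exact hω.trans (le_abs_self _)

end EventuallyLikely

/-! ## Convergence in distribution -/

/-- Two random vectors that are close in probability have laws that are close in the
Lévy–Prokhorov metric. -/
lemma levyProkhorovEDist_map_le {N : ℕ} {U W : Ω → Fin N → ℝ} (hU : Measurable U)
    (hW : Measurable W) {δ : ℝ} (hδ : 0 < δ)
    (h : μ {ω | ¬ ∀ i, |U ω i - W ω i| < δ} ≤ ENNReal.ofReal δ) :
    levyProkhorovEDist (μ.map U) (μ.map W) ≤ ENNReal.ofReal δ := by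
  have key : ∀ {U W : Ω → Fin N → ℝ}, Measurable U → Measurable W →
      μ {ω | ¬ ∀ i, |U ω i - W ω i| < δ} ≤ ENNReal.ofReal δ →
      ∀ (ε : ENNReal) (B : Set (Fin N → ℝ)), ENNReal.ofReal δ < ε → ε < ⊤ → MeasurableSet B →
        μ.map U B ≤ μ.map W (Metric.thickening ε.toReal B) + ε := by
    intro U W hU hW h ε B hε hε' hB
    have hδε : δ < ε.toReal := (ENNReal.ofReal_lt_iff_lt_toReal hδ.le hε'.ne).1 hε
    rw [Measure.map_apply hU hB, Measure.map_apply hW Metric.isOpen_thickening.measurableSet]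
    calc μ (U ⁻¹' B) ≤ μ (W ⁻¹' Metric.thickening ε.toReal B ∪ {ω | ¬ ∀ i, |U ω i - W ω i| < δ}) := by
          apply measure_mono
          intro ω hω
          by_cases hc : ∀ i, |U ω i - W ω i| < δ
          · left
            rw [Set.mem_preimage, Metric.mem_thickening_iff]
            refine ⟨U ω, hω, ?_⟩
            rw [dist_comm]
            refine lt_of_le_of_lt ?_ hδε
            exact (dist_pi_le_iff hδ.le).2 fun i => by rw [Real.dist_eq]; exact (hc i).le
          · exact Or.inr hc
      _ ≤ _ := measure_union_le _ _
      _ ≤ _ := by gcongr; exact h.trans hε.le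
  refine levyProkhorovEDist_le_of_forall _ _ _ fun ε B hε hε' hB =>
    ⟨key hU hW h ε B hε hε' hB, key hW hU ?_ ε B hε hε' hB⟩
  simpa only [abs_sub_comm] using h

/-- Only finitely many coordinates are compared at a time, so it suffices that each fixed coordinate
of the difference tends to 0 in probability; a union bound does the rest. The laws of W n need not
converge. -/
lemma convergesInDistribution_of_sub {U W : (n : ℕ) → Ω → Fin n → ℝ}
    (hU : ∀ n t, Measurable fun ω => U n ω t) (hW : ∀ n t, Measurable fun ω => W n ω t)
    (h : ∀ (t : ℕ) (δ : ℝ), 0 < δ → Tendsto (fun n => μ {ω | ¬ ∀ ht : t < n,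
      |U n ω ⟨t, ht⟩ - W n ω ⟨t, ht⟩| < δ}) atTop (𝓝 0)) :
    ConvergesInDistribution μ U W := by
  intro N
  have hmeas : ∀ {V : (n : ℕ) → Ω → Fin n → ℝ}, (∀ n t, Measurable fun ω => V n ω t) →
      ∀ n, Measurable fun ω => firstCoords N (V n ω) := by
    intro V hV n
    refine measurable_pi_lambda _ fun i => ?_
    by_cases hi : (i : ℕ) < n
    · simpa [firstCoords, hi] using hV n ⟨i, hi⟩
    · simp [firstCoords, hi]
  rw [ENNReal.tendsto_nhds_zero]
  intro ε hε
  obtain ⟨δ, hδ0, hδε⟩ := ENNReal.lt_iff_exists_nnreal_btwn.1 hε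
  have hδ : (0 : ℝ) < δ := by exact_mod_cast hδ0
  have hsum : Tendsto (fun n => ∑ i : Fin N, μ {ω | ¬ ∀ ht : (i : ℕ) < n,
      |U n ω ⟨i, ht⟩ - W n ω ⟨i, ht⟩| < δ}) atTop (𝓝 0) := by
    have := tendsto_finsetSum Finset.univ fun (i : Fin N) _ => h i δ hδ
    simpa using this
  filter_upwards [hsum.eventually_le_const (u := ENNReal.ofReal δ) (ENNReal.ofReal_pos.2 hδ)] with n hn
  refine (levyProkhorovEDist_map_le (hmeas hU n) (hmeas hW n) hδ ?_).trans
    (by rw [ENNReal.ofReal_coe_nnreal]; exact hδε.le)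
  refine le_trans ((measure_mono ?_).trans (measure_iUnion_fintype_le μ _)) hn
  intro ω hω
  simp only [Set.mem_ofPred_eq, not_forall, Set.mem_iUnion] at hω ⊢
  obtain ⟨i, hi⟩ := hω
  by_cases hin : (i : ℕ) < n
  · exact ⟨i, hin, by simpa [firstCoords, hin] using hi⟩
  · simp [firstCoords, hin] at hi
    linarith

end Probability

/-! ### Measurability of the residuals -/

section Measurability

variable {Ω : Type*} [MeasurableSpace Ω]

/-- A random matrix with measurable entries. -/
def EntryMeasurable {ι κ : Type*} (A : Ω → Matrix ι κ ℝ) : Prop :=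
  ∀ i j, Measurable fun ω => A ω i j

namespace EntryMeasurable

variable {ι κ τ : Type*}

lemma mul [Fintype κ] {A : Ω → Matrix ι κ ℝ} {B : Ω → Matrix κ τ ℝ} (hA : EntryMeasurable A)
    (hB : EntryMeasurable B) : EntryMeasurable fun ω => A ω * B ω := fun i j => by
  simp only [Matrix.mul_apply]
  exact Finset.measurable_fun_sum _ fun k _ => (hA i k).mul (hB k j)

lemma transpose {A : Ω → Matrix ι κ ℝ} (hA : EntryMeasurable A) :
    EntryMeasurable fun ω => (A ω)ᵀ := fun i j => hA j i

lemma add {A B : Ω → Matrix ι κ ℝ} (hA : EntryMeasurable A) (hB : EntryMeasurable B) :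
    EntryMeasurable fun ω => A ω + B ω := fun i j => (hA i j).add (hB i j)

lemma sub {A B : Ω → Matrix ι κ ℝ} (hA : EntryMeasurable A) (hB : EntryMeasurable B) :
    EntryMeasurable fun ω => A ω - B ω := fun i j => (hA i j).sub (hB i j)

lemma const (A : Matrix ι κ ℝ) : EntryMeasurable fun _ : Ω => A := fun _ _ => measurable_const

lemma mulVec [Fintype κ] {A : Ω → Matrix ι κ ℝ} {v : Ω → κ → ℝ} (hA : EntryMeasurable A)
    (hv : ∀ j, Measurable fun ω => v ω j) (i : ι) : Measurable fun ω => (A ω *ᵥ v ω) i :=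
  Finset.measurable_fun_sum _ fun j _ => (hA i j).mul (hv j)

lemma det [Fintype ι] [DecidableEq ι] {A : Ω → Matrix ι ι ℝ} (hA : EntryMeasurable A) :
    Measurable fun ω => (A ω).det := by
  simp only [Matrix.det_apply']
  exact Finset.measurable_fun_sum _ fun σ _ =>
    (Finset.measurable_fun_prod _ fun i _ => hA (σ i) i).const_mul _

/-- The adjugate formula also holds at singular matrices, where the inverse is zero by convention,
so invertibility is not needed. -/
lemma inv [Fintype ι] [DecidableEq ι] {A : Ω → Matrix ι ι ℝ} (hA : EntryMeasurable A) :
    EntryMeasurable fun ω => (A ω)⁻¹ := fun i j => by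
  simp only [Matrix.inv_def, Matrix.smul_apply, Ring.inverse_eq_inv, smul_eq_mul,
    Matrix.adjugate_apply]
  refine hA.det.inv.mul (det fun a b => ?_)
  by_cases h : a = j
  · subst h
    simp
  · simpa [Matrix.updateRow_apply, h] using hA a b

end EntryMeasurable

namespace Model

variable {r : ℕ} (D : Model Ω r) (n : ℕ)

lemma entryMeasurable_X : EntryMeasurable (D.X n) :=
  ((show EntryMeasurable (D.F n) from D.measurable_F n).mul (EntryMeasurable.const _)).add
    (D.measurable_E n)

lemma entryMeasurable_XJ : EntryMeasurable (D.XJ n) := fun t j => D.entryMeasurable_X n t j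

lemma measurable_Y (t : Fin n) : Measurable fun ω => D.Y n ω t :=
  ((D.entryMeasurable_X n).mulVec (v := fun _ => D.β n) (fun _ => measurable_const) t).add (D.measurable_err n t)

lemma measurable_wJ (t : Fin n) : Measurable fun ω => D.wJ n ω t :=
  (D.measurable_Y n t).sub ((D.entryMeasurable_XJ n).mulVec (v := fun _ => D.βJ n)
    (fun _ => measurable_const) t)

lemma measurable_wtildeJ {k : ℕ} {Fh : Ω → Matrix (Fin n) (Fin k) ℝ} (hF : EntryMeasurable Fh)
    (t : Fin n) : Measurable fun ω => D.wtildeJ n ω (Fh ω) t := by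
  have hP : EntryMeasurable fun ω => projMat (Fh ω) :=
    (hF.mul (hF.transpose.mul hF).inv).mul hF.transpose
  have hX : EntryMeasurable fun ω => D.XtildeJ n ω (Fh ω) :=
    ((EntryMeasurable.const 1).sub hP).mul (D.entryMeasurable_XJ n)
  exact (D.measurable_Y n t).sub ((D.entryMeasurable_XJ n).mulVec
    ((hX.transpose.mul hX).inv.mulVec (hX.transpose.mulVec (D.measurable_Y n))) t)

/-- The type of the factor matrix depends on the random k. The real-valued residuals for each fixed
k form a family indexed by a countable set, and evaluating it at a measurable index is measurable.
-/
lemma measurable_wtildeJ_comp {Fh : Ω → (k : ℕ) → Matrix (Fin n) (Fin k) ℝ}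
    (hF : ∀ k t a, Measurable fun ω => Fh ω k t a) {kh : Ω → ℕ} (hk : Measurable kh) (t : Fin n) :
    Measurable fun ω => D.wtildeJ n ω (Fh ω (kh ω)) t := by
  have hk' : ∀ k, Measurable fun ω => D.wtildeJ n ω (Fh ω k) t := fun k =>
    D.measurable_wtildeJ (Fh := fun ω => Fh ω k) n (hF k) t
  generalize hg : (fun (k : ℕ) ω => D.wtildeJ n ω (Fh ω k) t) = g
  have hgk : ∀ k, Measurable (g k) := by
    subst hg
    exact hk'
  have hcomp : (fun ω => D.wtildeJ n ω (Fh ω (kh ω)) t) = fun ω => g (kh ω) ω := by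
    subst hg
    rfl
  rw [hcomp]
  have key : Measurable (Function.uncurry g) := measurable_from_prod_countable_right hgk
  exact key.comp (hk.prodMk measurable_id)

end Model

end Measurability

/-! ### Expectations of the sample quantities -/

section Moments

variable {Ω : Type*} [MeasurableSpace Ω] {μ : Measure Ω} {r : ℕ}

namespace Model

variable {D : Model Ω r} {M : ℝ} {n : ℕ}

lemma FactorAssumptions.expLE_sq [IsProbabilityMeasure μ] (hB : D.FactorAssumptions μ M) (t : Fin n) (i : Fin (D.p n)) :
    ExpLE μ (fun ω => D.E n ω t i ^ 2) (1 + M) :=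
  ((expLE_const 1).add (hB.idio_moment n t i)).mono ((D.measurable_E n t i).pow_const 2)
    (fun _ => sq_nonneg _) fun _ => sq_le_one_add_abs_pow_eight _

lemma FactorAssumptions.integrable_mul [IsProbabilityMeasure μ] (hB : D.FactorAssumptions μ M) (s t : Fin n)
    (i j : Fin (D.p n)) : Integrable (fun ω => D.E n ω s i * D.E n ω t j) μ := by
  refine ((hB.expLE_sq s i).1.add (hB.expLE_sq t j).1).mono'
    ((D.measurable_E n s i).mul (D.measurable_E n t j)).aestronglyMeasurable
    (Eventually.of_forall fun ω => ?_)
  simp only [Pi.add_apply, Real.norm_eq_abs]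
  exact abs_le.2 ⟨by nlinarith [sq_nonneg (D.E n ω s i + D.E n ω t j)],
    by nlinarith [sq_nonneg (D.E n ω s i - D.E n ω t j)]⟩

lemma FactorAssumptions.abs_integral_mul_le [IsProbabilityMeasure μ] (hB : D.FactorAssumptions μ M) (s t : Fin n)
    (i j : Fin (D.p n)) : |∫ ω, D.E n ω s i * D.E n ω t j ∂μ| ≤ 1 + M := by
  have h1 : ExpLE μ (fun ω => 1 / 2 * (D.E n ω s i ^ 2 + D.E n ω t j ^ 2)) (1 + M) :=
    (((hB.expLE_sq s i).add (hB.expLE_sq t j)).const_mul (by norm_num)).trans (by linarith)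
  refine (abs_integral_le_integral_abs).trans
    ((integral_mono (hB.integrable_mul s t i j).abs h1.1 fun ω => ?_).trans h1.2)
  exact abs_le.2 ⟨by nlinarith [sq_nonneg (D.E n ω s i + D.E n ω t j)],
    by nlinarith [sq_nonneg (D.E n ω s i - D.E n ω t j)]⟩

lemma FactorAssumptions.expLE_idio [IsProbabilityMeasure μ] (hB : D.FactorAssumptions μ M) :
    ExpLE μ (fun ω => frobSq (D.E n ω)) ((1 + M) * (n * D.p n)) := by
  refine ExpLE.trans (ExpLE.sum fun t _ => ExpLE.sum fun i _ => hB.expLE_sq t i) (le_of_eq ?_)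
  simp
  ring

lemma FactorAssumptions.expLE_idioJ [IsProbabilityMeasure μ] (hB : D.FactorAssumptions μ M) :
    ExpLE μ (fun ω => frobSq (D.EJ n ω)) ((1 + M) * (n * D.m n)) := by
  refine ExpLE.trans (ExpLE.sum fun t _ => ExpLE.sum fun (i : D.J n) _ => hB.expLE_sq t i.1)
    (le_of_eq ?_)
  simp [m]
  ring

/-- Expanding the square leaves, for each t and each factor, a double sum over i and j bounded by l²
Σ|τ_ij|; weak cross-sectional dependence makes it O(p) instead of O(p²). -/
lemma FactorAssumptions.expLE_idio_loading [IsProbabilityMeasure μ] (hB : D.FactorAssumptions μ M) (hp : 0 < D.p n)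
    {l : ℝ} (hl : ∀ j, √(∑ a, D.Lam n j a ^ 2) ≤ l) :
    ExpLE μ (fun ω => frobSq (D.E n ω * D.Lam n)) (r * l ^ 2 * M * (n * D.p n)) := by
  obtain ⟨τ, hτ, hτM⟩ := hB.idio_cross_dep n
  have hp' : (0 : ℝ) < D.p n := by exact_mod_cast hp
  have hτM' : ∑ i, ∑ j, |τ i j| ≤ D.p n * M := by
    rwa [one_div, inv_mul_le_iff₀ hp'] at hτM
  have hlam : ∀ j a, |D.Lam n j a| ≤ l := fun j a => by
    refine le_trans ?_ (hl j)
    refine Real.le_sqrt_of_sq_le ?_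
    rw [sq_abs]
    exact Finset.single_le_sum (f := fun a => D.Lam n j a ^ 2) (fun _ _ => sq_nonneg _)
      (Finset.mem_univ a)
  have hterm : ∀ (t : Fin n) (a : Fin r) (i j : Fin (D.p n)),
      ExpLE μ (fun ω => (D.Lam n i a * D.Lam n j a) * (D.E n ω t i * D.E n ω t j))
        (l ^ 2 * |τ i j|) := by
    intro t a i j
    refine ⟨(hB.integrable_mul t t i j).const_mul _, ?_⟩
    rw [integral_const_mul]
    refine (le_abs_self _).trans ?_
    rw [abs_mul, abs_mul, sq]
    have h0 : 0 ≤ l := (abs_nonneg _).trans (hlam i a)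
    exact mul_le_mul (mul_le_mul (hlam i a) (hlam j a) (abs_nonneg _) h0) (hτ t i j) (abs_nonneg _)
      (by positivity)
  have hsum : (fun ω => frobSq (D.E n ω * D.Lam n)) = fun ω => ∑ t, ∑ a, ∑ i, ∑ j,
      (D.Lam n i a * D.Lam n j a) * (D.E n ω t i * D.E n ω t j) := by
    funext ω
    simp only [frobSq, Matrix.mul_apply, sq, Finset.sum_mul_sum]
    refine Finset.sum_congr rfl fun t _ => Finset.sum_congr rfl fun a _ =>
      Finset.sum_congr rfl fun i _ => Finset.sum_congr rfl fun j _ => ?_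
    ring
  rw [hsum]
  refine ExpLE.trans (ExpLE.sum fun t _ => ExpLE.sum fun a _ => ExpLE.sum fun i _ =>
    ExpLE.sum fun j _ => hterm t a i j) ?_
  simp only [← Finset.mul_sum, Finset.sum_const, Finset.card_univ, Fintype.card_fin, nsmul_eq_mul]
  calc _ = (n : ℝ) * (r * (l ^ 2 * ∑ i, ∑ j, |τ i j|)) := by ring
    _ ≤ n * (r * (l ^ 2 * (D.p n * M))) := by gcongr
    _ = _ := by ring

/-- Each entry of E Eᵀ is √p ξ plus its mean p γ(s,t). The centred parts contribute O(p n²). For the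
means, γ² ≤ (1 + M)|γ| reduces the double sum to the assumed bound on Σ|γ|, giving O(p² n). -/
lemma FactorAssumptions.expLE_idio_gram [IsProbabilityMeasure μ] (hB : D.FactorAssumptions μ M) (hn : 0 < n)
    (hp : 0 < D.p n) : ExpLE μ (fun ω => frobSq (D.E n ω * (D.E n ω)ᵀ))
      (2 * D.p n * (1 + M) * n ^ 2 + 2 * (1 + M) * M * D.p n ^ 2 * n) := by
  have hp' : (0 : ℝ) < D.p n := by exact_mod_cast hp
  have hn' : (0 : ℝ) < n := by exact_mod_cast hn
  set γ : Fin n → Fin n → ℝ :=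
    fun s t => ∫ ω, (1 / (D.p n : ℝ)) * ∑ i, D.E n ω s i * D.E n ω t i ∂μ with hγ
  have hγeq : ∀ s t, D.p n * γ s t = ∑ i, ∫ ω, D.E n ω s i * D.E n ω t i ∂μ := by
    intro s t
    rw [hγ]
    simp only
    rw [integral_const_mul, integral_finsetSum _ fun i _ => hB.integrable_mul s t i i]
    field_simp
  have hγ1 : ∀ s t, |γ s t| ≤ 1 + M := by
    intro s t
    have h1 : |D.p n * γ s t| ≤ D.p n * (1 + M) := by
      rw [hγeq]
      refine (Finset.abs_sum_le_sum_abs _ _).trans ?_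
      refine (Finset.sum_le_sum fun i _ => hB.abs_integral_mul_le s t i i).trans ?_
      simp [mul_add]
    rw [abs_mul, abs_of_pos hp'] at h1
    exact le_of_mul_le_mul_left h1 hp'
  have hγM : ∑ s, ∑ t, |γ s t| ≤ n * M := by
    have := hB.idio_time_dep n
    rwa [one_div, inv_mul_le_iff₀ hn'] at this
  have hterm : ∀ s t, ExpLE μ (fun ω => (D.E n ω * (D.E n ω)ᵀ) s t ^ 2)
      (2 * D.p n * (1 + M) + 2 * D.p n ^ 2 * ((1 + M) * |γ s t|)) := by
    intro s t
    have h1 := ((((expLE_const 1).add (hB.idio_fourth n t s)).const_mul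
      (by positivity : (0 : ℝ) ≤ 2 * D.p n)).add
        (expLE_const (μ := μ) (2 * D.p n ^ 2 * γ s t ^ 2)))
    refine (h1.mono ?_ (fun _ => sq_nonneg _) fun ω => ?_).trans ?_
    · have hE : EntryMeasurable (D.E n) := D.measurable_E n
      exact (hE.mul hE.transpose s t).pow_const 2
    · set ξ := (1 / √(D.p n : ℝ)) *
        ∑ i, (D.E n ω s i * D.E n ω t i - ∫ ω', D.E n ω' s i * D.E n ω' t i ∂μ) with hξ
      have h2 : (D.E n ω * (D.E n ω)ᵀ) s t = √(D.p n : ℝ) * ξ + D.p n * γ s t := by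
        have h3 : √(D.p n : ℝ) * ξ
            = ∑ i, (D.E n ω s i * D.E n ω t i - ∫ ω', D.E n ω' s i * D.E n ω' t i ∂μ) := by
          rw [hξ, ← mul_assoc, mul_one_div, div_self (Real.sqrt_pos.2 hp').ne', one_mul]
        rw [h3, hγeq, Finset.sum_sub_distrib, sub_add_cancel, Matrix.mul_apply]
        rfl
      rw [h2]
      have h4 := sq_le_one_add_abs_pow_four ξ
      have h5 := Real.sq_sqrt hp'.le
      calc (√(D.p n : ℝ) * ξ + D.p n * γ s t) ^ 2
          ≤ 2 * ((√(D.p n : ℝ) * ξ) ^ 2 + (D.p n * γ s t) ^ 2) := add_sq_le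
        _ = 2 * D.p n * ξ ^ 2 + 2 * D.p n ^ 2 * γ s t ^ 2 := by rw [mul_pow, h5]; ring
        _ ≤ _ := by gcongr
    · rw [← sq_abs (γ s t), sq (|γ s t|)]
      gcongr
      exact hγ1 s t
  refine ExpLE.trans (ExpLE.sum fun s _ => ExpLE.sum fun t _ => hterm s t) ?_
  simp only [Finset.sum_add_distrib, ← Finset.mul_sum, Finset.sum_const, Finset.card_univ,
    Fintype.card_fin, nsmul_eq_mul]
  have hM : 0 ≤ 1 + M := (abs_nonneg _).trans (hγ1 ⟨0, hn⟩ ⟨0, hn⟩)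
  calc _ = 2 * D.p n * (1 + M) * n ^ 2
        + 2 * D.p n ^ 2 * ((1 + M) * ∑ s, ∑ t, |γ s t|) := by ring
    _ ≤ 2 * D.p n * (1 + M) * n ^ 2 + 2 * D.p n ^ 2 * ((1 + M) * (n * M)) := by gcongr
    _ = _ := by ring

/-- Undoing the normalisation of sample covariances. -/
lemma scaled_sum_eq {ι : Type*} (s : Finset ι) (hn : 0 < n) (x : ι → ℝ) :
    (n * s.card : ℝ) * ((1 / (s.card : ℝ)) * ∑ j ∈ s, ((1 / √(n : ℝ)) * x j) ^ 2)
      = ∑ j ∈ s, x j ^ 2 := by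
  have hn' : (0 : ℝ) < n := by exact_mod_cast hn
  rcases s.eq_empty_or_nonempty with rfl | hs
  · simp
  · have hc : (0 : ℝ) < s.card := by exact_mod_cast hs.card_pos
    simp only [mul_pow, ← Finset.mul_sum, div_pow, Real.sq_sqrt hn'.le]
    field_simp

lemma SelectionAssumptions.expLE_factor_idio (hC : D.SelectionAssumptions μ M) (hn : 0 < n) :
    ExpLE μ (fun ω => frobSq ((D.F n ω)ᵀ * D.EJ n ω)) (M * (n * D.m n)) := by
  have h := (hC.factor_dep n).const_mul (by positivity : (0 : ℝ) ≤ n * D.m n)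
  convert h using 1
  · funext ω
    -- The sum over the factors is written as a single square, the form required by `scaled_sum_eq`.
    have h1 : ∀ j, ∑ a, ((1 / √(n : ℝ)) * ∑ t, D.F n ω t a * D.E n ω t j) ^ 2
        = ((1 / √(n : ℝ)) * √(∑ a, (∑ t, D.F n ω t a * D.E n ω t j) ^ 2)) ^ 2 := by
      intro j
      rw [mul_pow, Real.sq_sqrt (by positivity), Finset.mul_sum]
      simp only [mul_pow]
    simp only [h1]
    rw [m, scaled_sum_eq _ hn, frobSq, Finset.sum_comm, ← Finset.sum_coe_sort (D.J n)]
    refine Finset.sum_congr rfl fun j _ => ?_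
    rw [Real.sq_sqrt (by positivity)]
    simp [Matrix.mul_apply, EJ]
  · ring

lemma SelectionAssumptions.expLE_err_idio (hC : D.SelectionAssumptions μ M) (hn : 0 < n) :
    ExpLE μ (fun ω => ∑ j ∈ D.J n, (∑ t, D.err n ω t * D.E n ω t j) ^ 2) (M * (n * D.m n)) := by
  have h := (hC.err_dep n).const_mul (by positivity : (0 : ℝ) ≤ n * D.m n)
  convert h using 1
  · funext ω
    rw [m, scaled_sum_eq _ hn]
  · ring

lemma SelectionAssumptions.expLE_idio_idio (hC : D.SelectionAssumptions μ M) (hn : 0 < n)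
    {i : Fin (D.p n)} (hi : i ∉ D.J n) :
    ExpLE μ (fun ω => ∑ j ∈ D.J n, (∑ t, D.E n ω t i * D.E n ω t j) ^ 2) (M * (n * D.m n)) := by
  have h := (hC.idio_dep n i hi).const_mul (by positivity : (0 : ℝ) ≤ n * D.m n)
  convert h using 1
  · funext ω
    rw [m, scaled_sum_eq _ hn]
  · ring

lemma DesignAssumptions.sum_abs_βc_le (hA : D.DesignAssumptions μ M) (n : ℕ) :
    ∑ i, |D.βc n i| ≤ M := by
  refine le_trans (Finset.sum_le_sum fun i _ => ?_) (hA.coeff_bound n)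
  by_cases h : i ∈ D.J n <;> simp [βc, h]

lemma DesignAssumptions.nonneg (hA : D.DesignAssumptions μ M) : 0 ≤ M :=
  le_trans (Finset.sum_nonneg fun _ _ => abs_nonneg _) (hA.coeff_bound 0)

/-- The weights `βc` vanish on J, so covariance bounds are needed only for unselected indices, the
only ones for which `idio_dep` gives them. -/
lemma expLE_weighted [IsProbabilityMeasure μ] (hA : D.DesignAssumptions μ M) {Z : Fin (D.p n) → Ω → ℝ} {C : ℝ}
    (hC : 0 ≤ C) (hZ : ∀ i ∉ D.J n, ExpLE μ (Z i) C) :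
    ExpLE μ (fun ω => M * ∑ i, |D.βc n i| * Z i ω) (M * (M * C)) := by
  refine ExpLE.const_mul ?_ hA.nonneg
  have h : ∀ i ∈ Finset.univ, ExpLE μ (fun ω => |D.βc n i| * Z i ω) (|D.βc n i| * C) := by
    intro i _
    by_cases hi : i ∈ D.J n
    · have : D.βc n i = 0 := by simp [βc, hi]
      simp only [this, abs_zero, zero_mul]
      exact expLE_const 0
    · exact (hZ i hi).const_mul (abs_nonneg _)
  refine (ExpLE.sum h).trans ?_
  rw [← Finset.sum_mul]
  exact mul_le_mul_of_nonneg_right (hA.sum_abs_βc_le n) hC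

/-- The covariances of the selected idiosyncratic components with the noise are dominated by
variables of bounded expectation. -/
lemma sum_idio_noise_sq_le (hA : D.DesignAssumptions μ M) (ω : Ω) :
    ∑ j, ((D.EJ n ω)ᵀ *ᵥ D.noise n ω) j ^ 2
      ≤ 2 * (M * ∑ i, |D.βc n i| * ∑ j ∈ D.J n, (∑ t, D.E n ω t i * D.E n ω t j) ^ 2
        + ∑ j ∈ D.J n, (∑ t, D.err n ω t * D.E n ω t j) ^ 2) := by
  have h1 : ∀ j : D.J n, ((D.EJ n ω)ᵀ *ᵥ D.noise n ω) j
      = ∑ i, D.βc n i * (∑ t, D.E n ω t i * D.E n ω t j)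
        + ∑ t, D.err n ω t * D.E n ω t j := by
    intro j
    simp only [noise, Matrix.mulVec, dotProduct, Matrix.transpose_apply, EJ,
      Matrix.submatrix_apply, id, Pi.add_apply, mul_add, Finset.sum_add_distrib, Finset.mul_sum]
    rw [Finset.sum_comm]
    congr 1
    · exact Finset.sum_congr rfl fun _ _ => Finset.sum_congr rfl fun _ _ => by ring
    · exact Finset.sum_congr rfl fun _ _ => by ring
  have h2 : ∀ j : D.J n, ((D.EJ n ω)ᵀ *ᵥ D.noise n ω) j ^ 2
      ≤ 2 * (M * ∑ i, |D.βc n i| * (∑ t, D.E n ω t i * D.E n ω t j) ^ 2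
        + (∑ t, D.err n ω t * D.E n ω t j) ^ 2) := by
    intro j
    rw [h1]
    refine add_sq_le.trans ?_
    gcongr
    refine (sq_sum_mul_le _ _ _).trans ?_
    gcongr
    exact hA.sum_abs_βc_le n
  refine (Finset.sum_le_sum fun j _ => h2 j).trans (le_of_eq ?_)
  rw [← Finset.mul_sum, Finset.sum_add_distrib, ← Finset.mul_sum, Finset.sum_comm,
    ← Finset.sum_coe_sort (D.J n) fun j => (∑ t, D.err n ω t * D.E n ω t j) ^ 2]
  congr 4
  funext i
  rw [← Finset.mul_sum, ← Finset.sum_coe_sort (D.J n)]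

lemma sum_noise_sq_le (hA : D.DesignAssumptions μ M) (ω : Ω) :
    ∑ t, D.noise n ω t ^ 2
      ≤ 2 * (M * ∑ i, |D.βc n i| * ∑ t, D.E n ω t i ^ 2 + ∑ t, D.err n ω t ^ 2) := by
  have h2 : ∀ t, D.noise n ω t ^ 2
      ≤ 2 * (M * ∑ i, |D.βc n i| * D.E n ω t i ^ 2 + D.err n ω t ^ 2) := by
    intro t
    have h1 : D.noise n ω t = ∑ i, D.βc n i * D.E n ω t i + D.err n ω t := by
      simp [noise, Matrix.mulVec, dotProduct, mul_comm]
    rw [h1]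
    refine add_sq_le.trans ?_
    gcongr
    refine (sq_sum_mul_le _ _ _).trans ?_
    gcongr
    exact hA.sum_abs_βc_le n
  refine (Finset.sum_le_sum fun j _ => h2 j).trans (le_of_eq ?_)
  rw [← Finset.mul_sum, Finset.sum_add_distrib, ← Finset.mul_sum, Finset.sum_comm]
  congr 4
  funext i
  rw [← Finset.mul_sum]

lemma FactorAssumptions.expLE_row [IsProbabilityMeasure μ] (hB : D.FactorAssumptions μ M) {l : ℝ}
    (hl : ∀ j, √(∑ a, D.Lam n j a ^ 2) ≤ l) (t : Fin n) {C : ℝ}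
    (hC : ExpLE μ (fun ω => (∑ a, D.F n ω t a ^ 2) ^ 2) C) :
    ExpLE μ (fun ω => ∑ j, D.XJ n ω t j ^ 2) (2 * (l ^ 2 * (1 + C) + (1 + M)) * D.m n) := by
  have hF : ExpLE μ (fun ω => ∑ a, D.F n ω t a ^ 2) (1 + C) := by
    refine ((expLE_const 1).add hC).mono
      (Finset.measurable_fun_sum _ fun a _ => (D.measurable_F n t a).pow_const 2)
      (fun ω => by positivity) fun ω => ?_
    nlinarith [sq_nonneg ((∑ a, D.F n ω t a ^ 2) - 1 / 2)]
  have hterm : ∀ j : D.J n, ExpLE μ (fun ω => D.XJ n ω t j ^ 2)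
      (2 * (l ^ 2 * (1 + C) + (1 + M))) := by
    intro j
    refine (((hF.const_mul (sq_nonneg l)).add (hB.expLE_sq t j.1)).const_mul zero_le_two).mono
      ((D.entryMeasurable_XJ n t j).pow_const 2) (fun _ => sq_nonneg _) fun ω => ?_
    have h1 : D.XJ n ω t j = ∑ a, D.F n ω t a * D.Lam n j a + D.E n ω t j := by
      simp [XJ, X, Matrix.mul_apply]
    rw [h1]
    refine add_sq_le.trans ?_
    gcongr
    refine (Finset.sum_mul_sq_le_sq_mul_sq _ _ _).trans ?_
    rw [mul_comm]
    have h3 : ∑ a, D.Lam n j a ^ 2 ≤ l ^ 2 := by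
      rw [← Real.sq_sqrt (Finset.sum_nonneg fun a _ => sq_nonneg (D.Lam n j a))]
      exact pow_le_pow_left₀ (Real.sqrt_nonneg _) (hl j) 2
    exact mul_le_mul_of_nonneg_right h3 (Finset.sum_nonneg fun _ _ => sq_nonneg _)
  refine (ExpLE.sum fun j _ => hterm j).trans (le_of_eq ?_)
  simp [m]
  ring

end Model

end Moments

/-! ### All sample bounds hold with high probability; convergence of the residual -/

section SampleBounds

attribute [local instance] Matrix.frobeniusNormedAddCommGroup Matrix.frobeniusNormedSpace

/-! ## Gram matrices close to a positive definite matrix -/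

lemma exists_pos_smul_one_le {ι : Type*} [Fintype ι] [DecidableEq ι] {S : Matrix ι ι ℝ}
    (hS : S.PosDef) : ∃ c : ℝ, 0 < c ∧ (S - c • (1 : Matrix ι ι ℝ)).PosSemidef := by
  obtain ⟨c, hc, hle⟩ : ∃ c : ℝ, 0 < c ∧ ∀ i, c ≤ hS.1.eigenvalues i := by
    rcases isEmpty_or_nonempty ι with h | h
    · exact ⟨1, one_pos, fun i => (h.false i).elim⟩
    · obtain ⟨i, hi⟩ := Finite.exists_min hS.1.eigenvalues
      exact ⟨_, hS.eigenvalues_pos i, hi⟩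
  refine ⟨c, hc, Matrix.posSemidef_iff_isHermitian_and_spectrum_nonneg.2 ⟨?_, ?_⟩⟩
  · refine hS.1.sub ?_
    rw [Matrix.IsHermitian, Matrix.conjTranspose_smul, Matrix.conjTranspose_one, star_trivial]
  · rw [← Algebra.algebraMap_eq_smul_one, ← spectrum.sub_singleton_eq,
      hS.1.spectrum_real_eq_range_eigenvalues]
    rintro x ⟨y, ⟨i, rfl⟩, z, rfl, rfl⟩
    exact sub_nonneg.2 (hle i)

/-- The quadratic form of S is at least c and the perturbation costs at most c/2. The constant does
not depend on the dimension, as needed for a growing set J. -/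
lemma norm_mul_sq_ge_of_gram {n : ℕ} {κ : Type*} [Fintype κ] [DecidableEq κ] (hn : 0 < n)
    {ι : Type*} [Fintype ι] {A : Matrix ι κ ℝ} {S : Matrix κ κ ℝ} {c : ℝ}
    (hS : (S - c • (1 : Matrix κ κ ℝ)).PosSemidef)
    (h : ‖(1 / (n : ℝ)) • (Aᵀ * A) - S‖ ≤ c / 2) {q : ℕ} (V : Matrix κ (Fin q) ℝ) :
    n * (c / 2 * ‖V‖ ^ 2) ≤ ‖A * V‖ ^ 2 := by
  have hn' : (0 : ℝ) < n := by exact_mod_cast hn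
  set G := (1 / (n : ℝ)) • (Aᵀ * A) with hG
  have h1 : ‖A * V‖ ^ 2 = n * (Vᵀ * (G * V)).trace := by
    rw [norm_sq_eq_trace, Matrix.transpose_mul, hG, Matrix.smul_mul, Matrix.mul_smul,
      Matrix.trace_smul, smul_eq_mul, ← mul_assoc, mul_one_div, div_self hn'.ne', one_mul]
    simp only [Matrix.mul_assoc]
  have h2 : (Vᵀ * (G * V)).trace
      = (Vᵀ * ((G - S) * V)).trace + (Vᵀ * (S - c • (1 : Matrix κ κ ℝ)) * V).trace
        + c * ‖V‖ ^ 2 := by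
    have h4 : Vᵀ * (S - c • (1 : Matrix κ κ ℝ)) * V = Vᵀ * (S * V) - c • (Vᵀ * V) := by
      rw [Matrix.mul_assoc, Matrix.sub_mul, Matrix.mul_sub, Matrix.smul_mul, Matrix.one_mul,
        Matrix.mul_smul]
    rw [h4, Matrix.sub_mul, Matrix.mul_sub, Matrix.trace_sub, Matrix.trace_sub, Matrix.trace_smul,
      norm_sq_eq_trace, smul_eq_mul]
    ring
  have h3 : 0 ≤ (Vᵀ * (S - c • (1 : Matrix κ κ ℝ)) * V).trace := by
    have := (hS.conjTranspose_mul_mul_same V).trace_nonneg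
    simpa only [Matrix.conjTranspose_eq_transpose_of_trivial] using this
  have h5 : -(c / 2 * ‖V‖ ^ 2) ≤ (Vᵀ * ((G - S) * V)).trace := by
    refine le_trans (neg_le_neg ?_) (neg_abs_le _)
    refine (abs_trace_mul_le _ _).trans ?_
    rw [Matrix.frobenius_norm_transpose]
    calc ‖V‖ * ‖(G - S) * V‖ ≤ ‖V‖ * (c / 2 * ‖V‖) := by
          gcongr
          refine (Matrix.frobenius_norm_mul _ _).trans ?_
          gcongr
      _ = _ := by ring
  rw [h1]
  refine mul_le_mul_of_nonneg_left ?_ hn'.le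
  rw [h2]
  linarith

/-- The norm of the identity brings in the square root of the dimension, so this serves for the
fixed number r of factors only. -/
lemma norm_sq_le_of_gram {n : ℕ} {κ : Type*} [Fintype κ] [DecidableEq κ] (hn : 0 < n)
    {ι : Type*} [Fintype ι] {A : Matrix ι κ ℝ} {S : Matrix κ κ ℝ} {c : ℝ}
    (h : ‖(1 / (n : ℝ)) • (Aᵀ * A) - S‖ ≤ c) :
    ‖A‖ ^ 2 ≤ ‖(1 : Matrix κ κ ℝ)‖ * (c + ‖S‖) * n := by
  have hn' : (0 : ℝ) < n := by exact_mod_cast hn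
  set G := (1 / (n : ℝ)) • (Aᵀ * A) with hG
  have h1 : ‖A‖ ^ 2 = n * ((1 : Matrix κ κ ℝ) * G).trace := by
    rw [norm_sq_eq_trace, Matrix.one_mul, hG, Matrix.trace_smul, smul_eq_mul, ← mul_assoc,
      mul_one_div, div_self hn'.ne', one_mul]
  have h2 : ‖G‖ ≤ c + ‖S‖ := by
    calc ‖G‖ = ‖(G - S) + S‖ := by rw [sub_add_cancel]
      _ ≤ _ := (norm_add_le _ _).trans (by gcongr)
  rw [h1, mul_comm]
  gcongr
  exact (le_abs_self _).trans ((abs_trace_mul_le _ _).trans (by gcongr))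

variable {Ω : Type*} [MeasurableSpace Ω] {μ : Measure Ω} {r : ℕ}

namespace Model

variable {D : Model Ω r} {M : ℝ}

lemma DesignAssumptions.eventually_dim (hA : D.DesignAssumptions μ M) :
    ∃ K₁ : ℝ, 1 ≤ K₁ ∧ ∀ᶠ n : ℕ in atTop, 0 < n ∧ 0 < D.p n ∧ (n : ℝ) ≤ K₁ * D.p n := by
  obtain ⟨c, hc, h⟩ := hA.p_growth
  refine ⟨max 1 (1 / c), le_max_left _ _, ?_⟩
  filter_upwards [h, eventually_gt_atTop 0] with n h1 h2
  have h2' : (0 : ℝ) < n := by exact_mod_cast h2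
  have h3 : (0 : ℝ) < D.p n := lt_of_lt_of_le (by positivity) h1
  refine ⟨h2, by exact_mod_cast h3, ?_⟩
  calc (n : ℝ) = 1 / c * (c * n) := by field_simp
    _ ≤ 1 / c * D.p n := by gcongr
    _ ≤ _ := by gcongr; exact le_max_right _ _

lemma norm_le_of_frobSq_lt {ι κ : Type*} [Fintype ι] [Fintype κ] {A : Matrix ι κ ℝ} {c : ℝ}
    (hc : 0 ≤ c) (h : frobSq A < c ^ 2) : ‖A‖ ≤ c :=
  le_of_sq_le_sq ((norm_sq_eq_frobSq A).trans_le h.le) hc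

lemma FactorAssumptions.eventuallyLikely_factor (hB : D.FactorAssumptions μ M) :
    EventuallyLikely μ fun K n ω => ‖D.F n ω‖ ^ 2 ≤ K * n ∧
      ∀ q (V : Matrix (Fin r) (Fin q) ℝ), n * ‖V‖ ^ 2 ≤ K * ‖D.F n ω * V‖ ^ 2 := by
  obtain ⟨S, hS, hlim⟩ := hB.factor_cov
  obtain ⟨c, hc, hSc⟩ := exists_pos_smul_one_le hS
  refine (EventuallyLikely.of_tendstoInMeasure hlim (δ := (c / 2) ^ 2) (by positivity)).mono
    (max (2 / c) (‖(1 : Matrix (Fin r) (Fin r) ℝ)‖ * (c / 2 + ‖S‖))) fun K hK => ?_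
  filter_upwards [eventually_gt_atTop 0] with n hn ω hω
  have h := norm_le_of_frobSq_lt (by positivity) hω
  refine ⟨(norm_sq_le_of_gram hn h).trans ?_, fun q V => ?_⟩
  · gcongr
    exact (le_max_right _ _).trans hK
  · have h1 := norm_mul_sq_ge_of_gram hn hSc h V
    calc n * ‖V‖ ^ 2 = 2 / c * (n * (c / 2 * ‖V‖ ^ 2)) := by field_simp
      _ ≤ 2 / c * ‖D.F n ω * V‖ ^ 2 := by gcongr
      _ ≤ _ := by gcongr; exact (le_max_left _ _).trans hK

lemma FactorAssumptions.eventually_loading_ge (hA : D.DesignAssumptions μ M)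
    (hB : D.FactorAssumptions μ M) :
    ∃ K₁ : ℝ, ∀ K ≥ K₁, ∀ᶠ n in atTop, ∀ q (V : Matrix (Fin r) (Fin q) ℝ),
      D.p n * ‖V‖ ^ 2 ≤ K * ‖D.Lam n * V‖ ^ 2 := by
  obtain ⟨S, hS, hlim⟩ := hB.loading_cov
  obtain ⟨c, hc, hSc⟩ := exists_pos_smul_one_le hS
  obtain ⟨_, _, hdim⟩ := hA.eventually_dim
  refine ⟨2 / c, fun K hK => ?_⟩
  filter_upwards [hdim, hlim.eventually_lt_const (u := (c / 2) ^ 2) (by positivity)]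
    with n ⟨_, hp, _⟩ hω q V
  have h := norm_le_of_frobSq_lt (by positivity) hω
  have h1 := norm_mul_sq_ge_of_gram hp hSc h V
  calc D.p n * ‖V‖ ^ 2 = 2 / c * (D.p n * (c / 2 * ‖V‖ ^ 2)) := by field_simp
    _ ≤ 2 / c * ‖D.Lam n * V‖ ^ 2 := by gcongr
    _ ≤ _ := by gcongr

lemma FactorAssumptions.eventuallyLikely_idio [IsProbabilityMeasure μ] (hB : D.FactorAssumptions μ M) :
    EventuallyLikely μ fun K n ω => ‖D.E n ω‖ ^ 2 ≤ K * (n * D.p n) :=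
  EventuallyLikely.of_expLE (fun n => by positivity) (fun _ _ => sq_nonneg _) (1 + M)
    (Eventually.of_forall fun n => by simpa only [norm_sq_eq_frobSq] using hB.expLE_idio)

lemma eventuallyLikely_factorBounds [IsProbabilityMeasure μ] (hA : D.DesignAssumptions μ M)
    (hB : D.FactorAssumptions μ M) :
    EventuallyLikely μ fun K n ω => FactorBounds K (D.F n ω) (D.Lam n) (D.E n ω) := by
  obtain ⟨K₁, hK₁, hdim⟩ := hA.eventually_dim
  obtain ⟨K₂, hload⟩ := hB.eventually_loading_ge hA
  obtain ⟨l, hl⟩ := hB.loading_bound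
  have hM := hA.nonneg
  have h1 : EventuallyLikely μ fun K n ω => ‖D.E n ω * D.Lam n‖ ^ 2 ≤ K * (n * D.p n) := by
    refine EventuallyLikely.of_expLE (fun n => by positivity) (fun _ _ => sq_nonneg _)
      (r * l ^ 2 * M) ?_
    filter_upwards [hdim] with n ⟨_, hp, _⟩
    simpa only [norm_sq_eq_frobSq] using hB.expLE_idio_loading hp (hl n)
  have h2 : EventuallyLikely μ
      fun K n ω => ‖D.E n ω * (D.E n ω)ᵀ‖ ^ 2 ≤ K * (D.p n ^ 2 * n) := by
    refine EventuallyLikely.of_expLE (fun n => by positivity) (fun _ _ => sq_nonneg _)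
      (2 * (1 + M) * K₁ + 2 * (1 + M) * M) ?_
    filter_upwards [hdim] with n ⟨hn, hp, hnp⟩
    have h := hB.expLE_idio_gram hn hp
    simp only [norm_sq_eq_frobSq]
    refine h.trans ?_
    calc 2 * D.p n * (1 + M) * n ^ 2 + 2 * (1 + M) * M * D.p n ^ 2 * n
        = 2 * D.p n * (1 + M) * n * n + 2 * (1 + M) * M * D.p n ^ 2 * n := by ring
      _ ≤ 2 * D.p n * (1 + M) * n * (K₁ * D.p n) + 2 * (1 + M) * M * D.p n ^ 2 * n := by gcongr
      _ = _ := by ring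
  refine ((hB.eventuallyLikely_factor.and h1).and h2).mono (max K₁ K₂) fun K hK => ?_
  filter_upwards [hdim, hload K ((le_max_right _ _).trans hK)]
    with n ⟨_, _, hnp⟩ hL ω ⟨⟨⟨hF1, hF2⟩, hEL⟩, hEE⟩
  have hKK₁ : K₁ ≤ K := (le_max_left _ _).trans hK
  exact ⟨hK₁.trans hKK₁, hnp.trans (by gcongr), hF1, fun V => hF2 _ V, fun V => hL _ V, hEL, hEE⟩

lemma DesignAssumptions.eventuallyLikely_err (hA : D.DesignAssumptions μ M) :
    EventuallyLikely μ fun K n ω => ∑ t, D.err n ω t ^ 2 ≤ K * n := by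
  intro η hη
  obtain ⟨K₀, h⟩ := hA.err_bound η hη
  refine ⟨K₀, fun K hK => ?_⟩
  filter_upwards [h, eventually_gt_atTop 0] with n h1 hn
  refine (measure_mono fun ω hω => ?_).trans h1
  have hn' : (0 : ℝ) < n := by exact_mod_cast hn
  simp only [Set.mem_ofPred_eq, not_le] at hω ⊢
  refine lt_of_lt_of_le ?_ (le_abs_self _)
  rw [one_div, lt_inv_mul_iff₀ hn', mul_comm]
  exact lt_of_le_of_lt (by gcongr) hω

lemma eventuallyLikely_noise [IsProbabilityMeasure μ] (hA : D.DesignAssumptions μ M) (hB : D.FactorAssumptions μ M) :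
    EventuallyLikely μ fun K n ω => ∑ t, D.noise n ω t ^ 2 ≤ K * n := by
  have hM := hA.nonneg
  have h1 : EventuallyLikely μ
      fun K n ω => M * ∑ i, |D.βc n i| * ∑ t, D.E n ω t i ^ 2 ≤ K * n := by
    refine EventuallyLikely.of_expLE (fun n => by positivity) (fun _ _ => by positivity)
      (M * (M * (1 + M))) (Eventually.of_forall fun n => ?_)
    refine (expLE_weighted hA (C := (1 + M) * n) (by positivity) fun i _ =>
      (ExpLE.sum fun t _ => hB.expLE_sq t i).trans ?_).trans (le_of_eq (by ring))
    simp only [Finset.sum_const, Finset.card_univ, Fintype.card_fin, nsmul_eq_mul]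
    exact le_of_eq (by ring)
  -- Two terms, each doubled, so each may use a quarter of K.
  refine ((h1.and hA.eventuallyLikely_err).rescale (c := 1 / 4) (by norm_num)).mono 0
    fun K hK => Eventually.of_forall fun n ω ⟨h2, h3⟩ => ?_
  refine (sum_noise_sq_le hA ω).trans ?_
  linarith

lemma eventuallyLikely_idio_noise [IsProbabilityMeasure μ] (hA : D.DesignAssumptions μ M)
    (hC : D.SelectionAssumptions μ M) :
    EventuallyLikely μ fun K n ω =>
      ∑ j, ((D.EJ n ω)ᵀ *ᵥ D.noise n ω) j ^ 2 ≤ K * (n * D.m n) := by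
  have hM := hA.nonneg
  have h1 : EventuallyLikely μ fun K n ω => M * ∑ i, |D.βc n i| *
      ∑ j ∈ D.J n, (∑ t, D.E n ω t i * D.E n ω t j) ^ 2 ≤ K * (n * D.m n) := by
    refine EventuallyLikely.of_expLE (fun n => by positivity) (fun _ _ => by positivity)
      (M * (M * M)) ?_
    filter_upwards [eventually_gt_atTop 0] with n hn
    exact (expLE_weighted hA (C := M * (n * D.m n)) (by positivity) fun i hi =>
      hC.expLE_idio_idio hn hi).trans (le_of_eq (by ring))
  have h2 : EventuallyLikely μ fun K n ω =>
      ∑ j ∈ D.J n, (∑ t, D.err n ω t * D.E n ω t j) ^ 2 ≤ K * (n * D.m n) := by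
    refine EventuallyLikely.of_expLE (fun n => by positivity) (fun _ _ => by positivity) M ?_
    filter_upwards [eventually_gt_atTop 0] with n hn
    exact hC.expLE_err_idio hn
  refine ((h1.and h2).rescale (c := 1 / 4) (by norm_num)).mono 0
    fun K hK => Eventually.of_forall fun n ω ⟨h2, h3⟩ => ?_
  refine (sum_idio_noise_sq_le hA ω).trans ?_
  linarith

lemma SelectionAssumptions.eventuallyLikely_idio_ge (hC : D.SelectionAssumptions μ M) :
    EventuallyLikely μ fun K n ω => ∀ V : Matrix (D.J n) (Fin 1) ℝ,
      n * ‖V‖ ^ 2 ≤ K * ‖D.EJ n ω * V‖ ^ 2 := by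
  obtain ⟨G, ⟨c, hc, hG⟩, hlim⟩ := hC.idio_cov
  refine (EventuallyLikely.of_tendstoInMeasure hlim (δ := (c / 2) ^ 2) (by positivity)).mono
    (2 / c) fun K hK => ?_
  filter_upwards [eventually_gt_atTop 0] with n hn ω hω V
  have h := norm_le_of_frobSq_lt (by positivity) hω
  have h1 := norm_mul_sq_ge_of_gram hn (hG n) h V
  calc n * ‖V‖ ^ 2 = 2 / c * (n * (c / 2 * ‖V‖ ^ 2)) := by field_simp
    _ ≤ 2 / c * ‖D.EJ n ω * V‖ ^ 2 := by gcongr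
    _ ≤ _ := by gcongr

lemma loading_row_sq_le {n : ℕ} {l : ℝ} (hl : ∀ j, √(∑ a, D.Lam n j a ^ 2) ≤ l)
    (j : Fin (D.p n)) : ∑ a, D.Lam n j a ^ 2 ≤ l ^ 2 := by
  rw [← Real.sq_sqrt (Finset.sum_nonneg fun a _ => sq_nonneg (D.Lam n j a))]
  exact pow_le_pow_left₀ (Real.sqrt_nonneg _) (hl j) 2

lemma sum_coeff_sq_le (hA : D.DesignAssumptions μ M) {n : ℕ} {l : ℝ}
    (hl : ∀ j, √(∑ a, D.Lam n j a ^ 2) ≤ l) :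
    ∑ a, ((D.Lam n)ᵀ *ᵥ D.βc n) a ^ 2 ≤ M * (M * l ^ 2) := by
  have hM := hA.nonneg
  have h1 : ∀ a, ((D.Lam n)ᵀ *ᵥ D.βc n) a ^ 2 ≤ M * ∑ i, |D.βc n i| * D.Lam n i a ^ 2 := by
    intro a
    have : ((D.Lam n)ᵀ *ᵥ D.βc n) a = ∑ i, D.βc n i * D.Lam n i a := by
      simp [Matrix.mulVec, dotProduct, mul_comm]
    rw [this]
    refine (sq_sum_mul_le _ _ _).trans ?_
    gcongr
    exact hA.sum_abs_βc_le n
  refine (Finset.sum_le_sum fun a _ => h1 a).trans ?_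
  rw [← Finset.mul_sum, Finset.sum_comm]
  gcongr
  calc ∑ i, ∑ a, |D.βc n i| * D.Lam n i a ^ 2 = ∑ i, |D.βc n i| * ∑ a, D.Lam n i a ^ 2 := by
        simp only [Finset.mul_sum]
    _ ≤ ∑ i, |D.βc n i| * l ^ 2 := by
        gcongr with i
        exact loading_row_sq_le hl i
    _ = (∑ i, |D.βc n i|) * l ^ 2 := by rw [Finset.sum_mul]
    _ ≤ M * l ^ 2 := by gcongr; exact hA.sum_abs_βc_le n

lemma eventuallyLikely_sampleBounds [IsProbabilityMeasure μ] (hA : D.DesignAssumptions μ M) (hB : D.FactorAssumptions μ M)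
    (hC : D.SelectionAssumptions μ M) : EventuallyLikely μ fun K n ω => D.SampleBounds n ω K := by
  obtain ⟨l, hl⟩ := hB.loading_bound
  have h1 : EventuallyLikely μ fun K n ω => ‖D.EJ n ω‖ ^ 2 ≤ K * (n * D.m n) :=
    EventuallyLikely.of_expLE (fun n => by positivity) (fun _ _ => sq_nonneg _) (1 + M)
      (Eventually.of_forall fun n => by simpa only [norm_sq_eq_frobSq] using hB.expLE_idioJ)
  have h2 : EventuallyLikely μ
      fun K n ω => ‖(D.F n ω)ᵀ * D.EJ n ω‖ ^ 2 ≤ K * (n * D.m n) := by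
    refine EventuallyLikely.of_expLE (fun n => by positivity) (fun _ _ => sq_nonneg _) M ?_
    filter_upwards [eventually_gt_atTop 0] with n hn
    simpa only [norm_sq_eq_frobSq] using hC.expLE_factor_idio hn
  refine ((((eventuallyLikely_factorBounds hA hB).and (h1.and h2)).and
    hC.eventuallyLikely_idio_ge).and ((eventuallyLikely_noise hA hB).and
    (eventuallyLikely_idio_noise hA hC))).mono (max (l ^ 2) (M * (M * l ^ 2))) fun K hK =>
    Eventually.of_forall fun n ω ⟨⟨⟨hF, hE, hFE⟩, hG⟩, hn, hEn⟩ => ?_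
  refine ⟨hF, ?_, hE, hFE, hG, (sum_coeff_sq_le hA (hl n)).trans ((le_max_right _ _).trans hK),
    hn, hEn⟩
  rw [norm_sq_eq_frobSq]
  calc frobSq (D.LamJ n) = ∑ j : D.J n, ∑ a, D.Lam n j a ^ 2 := rfl
    _ ≤ ∑ _j : D.J n, l ^ 2 := Finset.sum_le_sum fun j _ => loading_row_sq_le (hl n) j
    _ = l ^ 2 * D.m n := by simp [m, mul_comm]
    _ ≤ _ := by gcongr; exact (le_max_left _ _).trans hK

lemma eventuallyLikely_row [IsProbabilityMeasure μ] (hB : D.FactorAssumptions μ M) (t : ℕ) :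
    EventuallyLikely μ fun K n ω => ∀ ht : t < n, ∑ j, D.XJ n ω ⟨t, ht⟩ j ^ 2 ≤ K * D.m n := by
  obtain ⟨l, hl⟩ := hB.loading_bound
  obtain ⟨C, hC⟩ := hB.factor_moment t
  have h1 : EventuallyLikely μ fun K n ω =>
      (if ht : t < n then ∑ j, D.XJ n ω ⟨t, ht⟩ j ^ 2 else 0) ≤ K * D.m n := by
    refine EventuallyLikely.of_expLE (fun n => by positivity) (fun n ω => ?_)
      (2 * (l ^ 2 * (1 + C) + (1 + M))) ?_
    · split_ifs <;> positivity
    · filter_upwards [eventually_gt_atTop t] with n hn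
      simp only [hn, dif_pos]
      exact hB.expLE_row (hl n) _ (hC n hn)
  refine h1.mono 0 fun K _ => Eventually.of_forall fun n ω h ht => ?_
  simpa [ht] using h

lemma DesignAssumptions.eventually_m_le (hA : D.DesignAssumptions μ M) (C : ℝ) {ε : ℝ}
    (hε : 0 < ε) : ∀ᶠ n : ℕ in atTop, C * (D.m n : ℝ) ^ 2 ≤ ε * n := by
  have h : Tendsto (fun n : ℕ => C * ((D.m n : ℝ) ^ 2 / n)) atTop (𝓝 0) := by
    simpa using hA.m_growth.const_mul C
  filter_upwards [h.eventually_le_const hε, eventually_gt_atTop 0] with n h1 hn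
  have hn' : (0 : ℝ) < n := by exact_mod_cast hn
  rwa [← mul_div_assoc, div_le_iff₀ hn'] at h1

/-- If the number of factors is estimated consistently, the estimated residual converges in
distribution. -/
lemma convergesInDistribution_of_khat [IsProbabilityMeasure μ] (hr : 1 ≤ r) {kmax : ℕ} (hkmax : r ≤ kmax)
    (hA : D.DesignAssumptions μ M) (hB : D.FactorAssumptions μ M)
    (hC : D.SelectionAssumptions μ M)
    {Fhat : (n : ℕ) → Ω → (k : ℕ) → Matrix (Fin n) (Fin k) ℝ} {khat : ℕ → Ω → ℕ}
    (hFhat : ∀ n k t a, Measurable fun ω => Fhat n ω k t a) (hkhat : ∀ n, Measurable (khat n))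
    (hsel : ∀ᶠ n in atTop, ∀ᵐ ω ∂μ, IsFactorSelection (D.X n ω) kmax (Fhat n ω) (khat n ω))
    (hk : Tendsto (fun n => μ {ω | ¬ khat n ω = r}) atTop (𝓝 0)) :
    ConvergesInDistribution μ (fun n ω => D.wtildeJ n ω (Fhat n ω (khat n ω)))
      (fun n ω => D.wJ n ω) := by
  refine convergesInDistribution_of_sub
    (fun n t => D.measurable_wtildeJ_comp n (hFhat n) (hkhat n) t)
    (fun n t => D.measurable_wJ n t) fun t δ hδ => ?_
  refine EventuallyLikely.tendsto_of_mono (((eventuallyLikely_sampleBounds hA hB hC).and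
    (eventuallyLikely_row hB t)).and ((EventuallyLikely.of_tendsto hk).and
    (EventuallyLikely.of_ae hsel))) 0 fun K hK => ?_
  obtain ⟨_, _, hdim⟩ := hA.eventually_dim
  set K' := 42 * K ^ 8 * r ^ 2 with hK'
  have hK'0 : 0 ≤ K' := by positivity
  -- The growth condition m²/n → 0 enters twice: first to bring the final error below δ²/2, then,
  -- through m ≤ m², to keep the projected regression well conditioned.
  filter_upwards [hdim, hA.eventually_m_le (720 * K' ^ 6 * K) (show 0 < δ ^ 2 / 2 by positivity),
    hA.eventually_m_le (16 * K' ^ 3) one_pos,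
    tendsto_natCast_atTop_atTop.eventually_gt_atTop (20 * K ^ 7 * (r : ℝ) ^ 2)]
    with n ⟨hn, hp, _⟩ hm1 hm2 hn2 ω ⟨⟨hS, hrow⟩, hkr, hselω⟩ ht
  have hn' : (0 : ℝ) < n := by exact_mod_cast hn
  have hF := hselω.factor r hr hkmax
  have hmm : (D.m n : ℝ) ≤ (D.m n : ℝ) ^ 2 := by
    exact_mod_cast Nat.le_self_pow two_ne_zero _
  have h1 := hS.residual_error_sq_le hr hn hp hn2
    ((mul_le_mul_of_nonneg_left hmm (by positivity)).trans (by simpa using hm2)) hF ⟨t, ht⟩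
  have h2 : n * (D.wtildeJ n ω (Fhat n ω r) ⟨t, ht⟩ - D.wJ n ω ⟨t, ht⟩) ^ 2
      ≤ n * (δ ^ 2 / 2) := by
    refine h1.trans ?_
    calc _ ≤ 720 * K' ^ 6 * D.m n * (K * D.m n) := by gcongr; exact hrow ht
      _ = 720 * K' ^ 6 * K * (D.m n : ℝ) ^ 2 := by ring
      _ ≤ _ := hm1.trans (le_of_eq (by ring))
  have h3 := le_of_mul_le_mul_left h2 hn'
  rw [hkr]
  refine abs_lt_of_sq_lt_sq (lt_of_le_of_lt h3 ?_) hδ.le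
  have : 0 < δ ^ 2 := by positivity
  linarith

end Model

end SampleBounds

/-! ### Consistency of the estimated number of factors -/

section FactorNumber

attribute [local instance] Matrix.frobeniusNormedAddCommGroup Matrix.frobeniusNormedSpace

/-- The penalty per factor in the information criterion. -/
noncomputable def penalty (n p : ℕ) : ℝ :=
  (((n : ℝ) + p) / ((n : ℝ) * p)) * Real.log (((n : ℝ) * p) / ((n : ℝ) + p))

lemma infoCriterion_eq {n p k : ℕ} {X : Matrix (Fin n) (Fin p) ℝ} {Fh : Matrix (Fin n) (Fin k) ℝ}
    (h : 0 < residualSS X Fh) :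
    infoCriterion X Fh = ((Real.log (residualSS X Fh) + k * penalty n p : ℝ) : EReal) := by
  rw [infoCriterion, ENNReal.log_ofReal, if_neg (not_le.2 h), penalty, EReal.coe_add]
  congr 2
  ring

/-- On a sample satisfying the stated bounds the criterion is minimised at the true number of
factors only. -/
lemma FactorBounds.khat_eq {K κ θ : ℝ} {n p r kmax : ℕ} {F : Matrix (Fin n) (Fin r) ℝ}
    {Lam : Matrix (Fin p) (Fin r) ℝ} {E : Matrix (Fin n) (Fin p) ℝ}
    (h : FactorBounds K F Lam E) (hr : 1 ≤ r) (hkmax : r ≤ kmax) (hn : 0 < n) (hp : 0 < p)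
    (hlarge : (12 * r ^ 2 * K ^ 4) ^ 2 ≤ (n : ℝ)) (hκ : 0 < κ) (hθ : θ = κ / (4 * kmax))
    (hE : frobSq E ≤ K * (n * p)) (hEκ : κ * (n * p) ≤ frobSq E)
    (hspec : specNorm E ^ 2 < θ * (n * p * penalty n p)) (hg0 : 0 < penalty n p)
    (hg1 : penalty n p ≤ 1) (hg : r * penalty n p < Real.log (1 + 1 / (2 * K ^ 3 * r)))
    {Fhat : (k : ℕ) → Matrix (Fin n) (Fin k) ℝ} {khat : ℕ}
    (hsel : IsFactorSelection (F * Lamᵀ + E) kmax Fhat khat) : khat = r := by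
  set X := F * Lamᵀ + E with hX
  set g := penalty n p with hgdef
  have hK := h.one_le
  have hr' : (1 : ℝ) ≤ r := by exact_mod_cast hr
  have hkm : (r : ℝ) ≤ kmax := by exact_mod_cast hkmax
  have hkm0 : (0 : ℝ) < kmax := by linarith
  have hnp : (0 : ℝ) < n * p := by positivity
  -- The choice of θ makes the total loss from overfitting smaller than κ/2 · np penalties, where
  -- κ/2 · np is the lower bound for V proved next.
  have hσ : 2 * kmax * specNorm E ^ 2 < κ / 2 * (n * p * g) := by
    have h1 : 2 * kmax * specNorm E ^ 2 < 2 * kmax * (θ * (n * p * g)) := by gcongr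
    refine h1.trans_eq ?_
    rw [hθ]
    field_simp
    ring
  have hlow : ∀ k ≤ kmax, frobSq E - 2 * kmax * specNorm E ^ 2 ≤ residualSS X (Fhat k) := by
    intro k hk
    refine le_trans ?_ (frobSq_sub_le_residualSS F Lam E (Fhat k))
    have hk' : (k : ℝ) ≤ kmax := by exact_mod_cast hk
    have : (r + k : ℝ) ≤ 2 * kmax := by linarith
    gcongr
  have hpos : ∀ k ≤ kmax, κ / 2 * (n * p) ≤ residualSS X (Fhat k) := by
    intro k hk
    have h1 := hlow k hk
    have h2 : κ / 2 * (n * p * g) ≤ κ / 2 * (n * p) :=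
      mul_le_mul_of_nonneg_left (mul_le_of_le_one_right hnp.le hg1) (by positivity)
    linarith
  have hpos' : ∀ k ≤ kmax, 0 < residualSS X (Fhat k) := fun k hk =>
    lt_of_lt_of_le (by positivity) (hpos k hk)
  have hVr : residualSS X (Fhat r) ≤ frobSq E := by
    have h1 := residualSS_le_of_isFactorEstimate hn.ne' hp.ne' (hsel.factor r hr hkmax) F Lam
    rwa [hX, add_sub_cancel_left] at h1
  have hmin := hsel.minimal r hr hkmax
  rw [infoCriterion_eq (hpos' _ hsel.le_max), infoCriterion_eq (hpos' _ hkmax),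
    EReal.coe_le_coe_iff, ← hgdef] at hmin
  set V := residualSS X (Fhat khat) with hV
  set Vr := residualSS X (Fhat r) with hVrdef
  have hV0 : 0 < V := hpos' _ hsel.le_max
  have hVr0 : 0 < Vr := hpos' _ hkmax
  rcases lt_trichotomy khat r with hlt | heq | hgt
  · exfalso
    have h1 := h.residualSS_ge hn hlt hlarge (Fhat khat)
    rw [← hX, ← hV] at h1
    -- Underfitting raises V by a fixed factor, because V(r) ≤ ‖E‖² ≤ K n p; its logarithm exceeds
    -- the r penalties that can be saved.
    have h2 : Vr * (1 + 1 / (2 * K ^ 3 * r)) ≤ V := by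
      have h3 : Vr * (1 / (2 * K ^ 3 * r)) ≤ n * p / (2 * K ^ 2 * r) := by
        calc Vr * (1 / (2 * K ^ 3 * r)) ≤ K * (n * p) * (1 / (2 * K ^ 3 * r)) := by
              gcongr
              exact hVr.trans hE
          _ = _ := by field_simp
      linarith
    have h4 := Real.log_le_log (by positivity) h2
    rw [Real.log_mul hVr0.ne' (by positivity)] at h4
    have h5 : (0 : ℝ) ≤ khat * g := by positivity
    linarith
  · exact heq
  · exfalso
    -- Overfitting: log x ≤ x - 1 bounds the gain by (V(r) - V)/V, and this relative gain is below
    -- one penalty.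
    have h1 : Real.log Vr - Real.log V < g := by
      rw [← Real.log_div hVr0.ne' hV0.ne']
      refine (Real.log_le_sub_one_of_pos (by positivity)).trans_lt ?_
      rw [sub_lt_iff_lt_add, div_lt_iff₀ hV0]
      have h2 := hlow khat hsel.le_max
      have h3 := hpos khat hsel.le_max
      rw [← hV] at h2 h3
      have h4 : κ / 2 * (n * p) * g ≤ V * g := by gcongr
      nlinarith
    have h2 : (r : ℝ) + 1 ≤ khat := by exact_mod_cast hgt
    have h3 : (r + 1) * g ≤ khat * g := by gcongr
    linarith

variable {Ω : Type*} [MeasurableSpace Ω] {μ : Measure Ω} {r : ℕ}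

namespace Model

variable {D : Model Ω r} {M : ℝ}

/-- With n ≤ K₁ p the ratio is at least n/(1 + K₁). -/
lemma DesignAssumptions.tendsto_harmonic (hA : D.DesignAssumptions μ M) :
    Tendsto (fun n : ℕ => ((n : ℝ) * D.p n) / ((n : ℝ) + D.p n)) atTop atTop := by
  obtain ⟨K₁, hK₁, hdim⟩ := hA.eventually_dim
  have h1 : Tendsto (fun n : ℕ => (n : ℝ) * (1 / (1 + K₁))) atTop atTop :=
    tendsto_natCast_atTop_atTop.atTop_mul_const (by positivity)
  refine tendsto_atTop_mono' atTop ?_ h1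
  filter_upwards [hdim] with n ⟨hn, hp, hnp⟩
  have hn' : (0 : ℝ) < n := by exact_mod_cast hn
  have hp' : (0 : ℝ) < D.p n := by exact_mod_cast hp
  rw [mul_one_div, div_le_div_iff₀ (by positivity) (by positivity), mul_assoc]
  gcongr
  linarith

/-- The penalty is log x / x at x = np/(n+p), which tends to infinity. -/
lemma DesignAssumptions.tendsto_penalty (hA : D.DesignAssumptions μ M) :
    Tendsto (fun n : ℕ => penalty n (D.p n)) atTop (𝓝 0) := by
  have h := Real.isLittleO_log_id_atTop.tendsto_div_nhds_zero.comp hA.tendsto_harmonic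
  refine h.congr fun n => ?_
  simp only [Function.comp, id, penalty]
  rw [div_div_eq_mul_div, mul_div_assoc, mul_comm]

lemma DesignAssumptions.eventually_penalty_pos (hA : D.DesignAssumptions μ M) :
    ∀ᶠ n : ℕ in atTop, 0 < penalty n (D.p n) := by
  obtain ⟨_, _, hdim⟩ := hA.eventually_dim
  filter_upwards [hA.tendsto_harmonic.eventually_gt_atTop 1, hdim] with n h1 ⟨hn, hp, _⟩
  have := Real.log_pos h1
  exact mul_pos (by positivity) this

/-- Without a hidden factor the number of factors is estimated consistently. -/
lemma tendsto_khat_ne [IsProbabilityMeasure μ] (hr : 1 ≤ r) {kmax : ℕ} (hkmax : r ≤ kmax)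
    (hA : D.DesignAssumptions μ M) (hB : D.FactorAssumptions μ M) (hN : D.NoHiddenFactor μ)
    {Fhat : (n : ℕ) → Ω → (k : ℕ) → Matrix (Fin n) (Fin k) ℝ} {khat : ℕ → Ω → ℕ}
    (hsel : ∀ᶠ n in atTop, ∀ᵐ ω ∂μ, IsFactorSelection (D.X n ω) kmax (Fhat n ω) (khat n ω)) :
    Tendsto (fun n => μ {ω | ¬ khat n ω = r}) atTop (𝓝 0) := by
  obtain ⟨κ, hκ, hnd⟩ := hN.nondegenerate
  have hr' : (1 : ℝ) ≤ r := by exact_mod_cast hr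
  have hkm : (0 : ℝ) < kmax := by exact_mod_cast hr.trans hkmax
  have hnd' : EventuallyLikely μ fun _ n ω => κ * (n * D.p n) ≤ frobSq (D.E n ω) :=
    EventuallyLikely.of_tendsto (by simpa only [not_le] using hnd)
  have hspec := EventuallyLikely.of_tendstoInMeasure hN.spectral
    (show 0 < κ / (4 * kmax) by positivity)
  refine EventuallyLikely.tendsto_of_mono (((eventuallyLikely_factorBounds hA hB).and
    hB.eventuallyLikely_idio).and ((hnd'.and hspec).and (EventuallyLikely.of_ae hsel))) 1
    fun K hK => ?_
  obtain ⟨_, _, hdim⟩ := hA.eventually_dim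
  have hpen : Tendsto (fun n : ℕ => r * penalty n (D.p n)) atTop (𝓝 0) := by
    simpa using hA.tendsto_penalty.const_mul (r : ℝ)
  have hK0 : 0 < K := by linarith
  have hlog : 0 < Real.log (1 + 1 / (2 * K ^ 3 * r)) := Real.log_pos (by
    have : 0 < 1 / (2 * K ^ 3 * r) := by positivity
    linarith)
  filter_upwards [hdim, hA.eventually_penalty_pos, hA.tendsto_penalty.eventually_le_const one_pos,
    hpen.eventually_lt_const hlog,
    tendsto_natCast_atTop_atTop.eventually_ge_atTop ((12 * (r : ℝ) ^ 2 * K ^ 4) ^ 2)]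
    with n ⟨hn, hp, _⟩ hg0 hg1 hg hlarge ω ⟨⟨hF, hE⟩, ⟨hEκ, hs⟩, hselω⟩
  have hn' : (0 : ℝ) < n := by exact_mod_cast hn
  have hp' : (0 : ℝ) < D.p n := by exact_mod_cast hp
  refine hF.khat_eq hr hkmax hn hp hlarge hκ rfl (by rwa [← norm_sq_eq_frobSq]) hEκ ?_ hg0 hg1 hg
    hselω
  have hden : ((n : ℝ) + D.p n) * Real.log (((n : ℝ) * D.p n) / ((n : ℝ) + D.p n))
      = n * D.p n * penalty n (D.p n) := by
    rw [penalty]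
    field_simp
  rwa [hden, div_lt_iff₀ (by positivity)] at hs

lemma tendsto_ne_iff [IsProbabilityMeasure μ] {khat : ℕ → Ω → ℕ} (hkhat : ∀ n, Measurable (khat n))
    (k : ℕ) : Tendsto (fun n => μ {ω | ¬ khat n ω = k}) atTop (𝓝 0) ↔
      Tendsto (fun n => μ {ω | khat n ω = k}) atTop (𝓝 1) := by
  have hm : ∀ n, MeasurableSet {ω | khat n ω = k} := fun n => hkhat n (measurableSet_singleton k)
  have h1 : ∀ n, μ {ω | ¬ khat n ω = k} = 1 - μ {ω | khat n ω = k} := fun n =>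
    prob_compl_eq_one_sub (hm n)
  have h2 : ∀ n, μ {ω | khat n ω = k} = 1 - μ {ω | ¬ khat n ω = k} := fun n => by
    rw [h1, ENNReal.sub_sub_cancel ENNReal.one_ne_top prob_le_one]
  constructor
  · intro h
    have := ENNReal.Tendsto.sub (tendsto_const_nhds (x := (1 : ENNReal))) h
      (Or.inl ENNReal.one_ne_top)
    rw [tsub_zero] at this
    exact this.congr fun n => (h2 n).symm
  · intro h
    have := ENNReal.Tendsto.sub (tendsto_const_nhds (x := (1 : ENNReal))) h
      (Or.inl ENNReal.one_ne_top)
    rw [tsub_self] at this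
    exact this.congr fun n => (h1 n).symm

end Model

end FactorNumber

end FactorRegression

theorem lemma1 {Ω : Type*} [MeasurableSpace Ω] (μ : Measure Ω) [IsProbabilityMeasure μ]
    {r : ℕ} (hr : 1 ≤ r) (kmax : ℕ) (hkmax : r ≤ kmax)
    (D : FactorRegression.Model Ω r) (M : ℝ)
    (hA : D.DesignAssumptions μ M) (hB : D.FactorAssumptions μ M)
    (hC : D.SelectionAssumptions μ M)
    (Fhat : (n : ℕ) → Ω → (k : ℕ) → Matrix (Fin n) (Fin k) ℝ) (khat : ℕ → Ω → ℕ)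
    (hFhat : ∀ n k t a, Measurable fun ω => Fhat n ω k t a)
    (hkhat : ∀ n, Measurable (khat n))
    (hsel : ∀ᶠ n in atTop, ∀ᵐ ω ∂μ,
      FactorRegression.IsFactorSelection (D.X n ω) kmax (Fhat n ω) (khat n ω)) :
    (Tendsto (fun n => μ {ω | khat n ω = r}) atTop (𝓝 1) →
      FactorRegression.ConvergesInDistribution μ
        (fun n ω => D.wtildeJ n ω (Fhat n ω (khat n ω))) (fun n ω => D.wJ n ω)) ∧
    (D.NoHiddenFactor μ →
      Tendsto (fun n => μ {ω | khat n ω = r}) atTop (𝓝 1) ∧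
      FactorRegression.ConvergesInDistribution μ
        (fun n ω => D.wtildeJ n ω (Fhat n ω (khat n ω))) (fun n ω => D.wJ n ω)) := by
  have hconv := FactorRegression.Model.convergesInDistribution_of_khat hr hkmax hA hB hC hFhat
    hkhat hsel
  have hiff := FactorRegression.Model.tendsto_ne_iff (μ := μ) hkhat r
  refine ⟨fun h => hconv (hiff.2 h), fun hN => ?_⟩
  have hne := FactorRegression.Model.tendsto_khat_ne hr hkmax hA hB hN hsel
  exact ⟨hiff.1 hne, hconv hne⟩
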